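/- **Theorem (IVA nonidentifiability).** Let $N,K,V$ be natural numbers. For $1\le n\le N$ let $\mathbf S_n\in\mathbb R^{K\times V}$ be random matrices (source component matrices; row $k$ of $\mathbf S_n$ contains the $V$ samples of the $n$-th source in dataset $k$). Assume that $\mathbf S_1,\dots,\mathbf S_N$ are mutually independent and that $\mathbf S_n$ has an admissible density $p_n$: a probability density with respect to Lebesgue measure that has zero mean and finite second moments and that is weakly differentiable, with score function $\boldsymbol\Phi_n(\mathbf Y)=-\partial\log p_n(\mathbf Y)/\partial\mathbf Y\in\mathbb R^{K\times V}$ (i.e. $\partial p_n=-\boldsymbol\Phi_n p_n$ in the weak sense), the entries of $\boldsymbol\Phi_n(\mathbf S_n)$ having finite second moments. The samples need not be independent or identically distributed, and the rows of $\mathbf S_n$ may be dependent. The observations are $\mathbf X^{[k]}=\mathbf A^{[k]}\mathbf S^{[k]}\in\mathbb R^{N\times V}$, $1\le k\le K$, where $\mathbf A^{[k]}\in\mathbb R^{N\times N}$ is invertible and the $n$-th row of $\mathbf S^{[k]}$ is the $k$-th row of $\mathbf S_n$. The sources are *identifiable* if, whenever invertible matrices $\tilde{\mathbf A}^{[k]}$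 and independent sources $\tilde{\mathbf S}_1,\dots,\tilde{\mathbf S}_N$ with admissible densities give observations $(\tilde{\mathbf A}^{[k]}\tilde{\mathbf S}^{[k]})_k$ with the same joint distribution as $(\mathbf X^{[k]})_k$, then for every $k$ one has $\tilde{\mathbf A}^{[k]}=\mathbf A^{[k]}\boldsymbol\Lambda^{[k]}\mathbf P^{[k]}$ with a nonsingular diagonal matrix $\boldsymbol\Lambda^{[k]}$ and a permutation matrix $\mathbf P^{[k]}$. For $\alpha\subseteq\{1,\dots,K\}$ let $\mathrm{vec}_\alpha(\mathbf S_n)\in\mathbb R^{|\alpha|V}$ be the stacked columns of the submatrix of $\mathbf S_n$ with rows in $\alpha$, and $\mathbf R_{n,\alpha}=\mathbb E[\mathrm{vec}_\alpha(\mathbf S_n)\mathrm{vec}_\alpha(\mathbf S_n)^{\mathsf T}]$. The source $\mathbf S_n$ *has an $\alpha$-Gaussian component* if $\mathrm{vec}_\alpha(\mathbf S_n)$ is independent of $\mathrm{vec}_{\alpha^c}(\mathbf S_n)$, $\mathrm{vec}_\alpha(\mathbf S_n)\sim\mathcal N(\mathbf 0,\mathbf R_{n,\alpha})$, and $\mathbf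 R_{n,\alpha}$ is nonsingular. For $m\ne n$ let $$\mathbf F_{m,n}=\operatorname{cov}\begin{bmatrix}\operatorname{diag}(\boldsymbol\Phi_m(\mathbf S_m)\mathbf S_n^{\mathsf T})\\ \operatorname{diag}(\boldsymbol\Phi_n(\mathbf S_n)\mathbf S_m^{\mathsf T})\end{bmatrix}\in\mathbb R^{2K\times 2K}$$ be the block, associated with the pair $(m,n)$, of the Fisher information matrix of the demixing matrices at the solution. Consider the condition (C) there are a nonempty $\alpha\subseteq\{1,\dots,K\}$ and indices $m\neq n$ such that $\mathbf S_m$ and $\mathbf S_n$ both have an $\alpha$-Gaussian component and $\mathbf R_{m,\alpha}=(\mathbf I_V\otimes\mathbf D)\,\mathbf R_{n,\alpha}\,(\mathbf I_V\otimes\mathbf D)$ for some full-rank diagonal $\mathbf D\in\mathbb R^{|\alpha|\times|\alpha|}$. Then the sources are not identifiable if and only if (C) holds. Moreover, some block $\mathbf F_{m,n}$ with $m\ne n$ is singular if and only if (C) holds. -/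

import Mathlib

open MeasureTheory ProbabilityTheory Matrix
open scoped Kronecker

/-- Values of a source component matrix: `K` datasets (rows) and `V` samples (columns). -/
abbrev SCM (K V : ℕ) : Type := Fin K → Fin V → ℝ

namespace IVA

/-- The matrix with a single one at position `(k, v)`, i.e. the direction of the entry `(k, v)`. -/
def entryDir {K V : ℕ} (k : Fin K) (v : Fin V) : SCM K V := Pi.single k (Pi.single v 1)

/-- The multivariate score function `Φ(Y) = - ∂ log p(Y) / ∂ Y`, a `K × V` matrix. -/
noncomputable def score {K V : ℕ} (p : SCM K V → ℝ) (Y : SCM K V) :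
    Matrix (Fin K) (Fin V) ℝ :=
  Matrix.of fun k v => - lineDeriv ℝ (fun Z => Real.log (p Z)) Y (entryDir k v)

/-- The measure on `K × V` matrices with density `p` with respect to Lebesgue measure. -/
noncomputable def sourceLaw {K V : ℕ} (p : SCM K V → ℝ) : Measure (SCM K V) :=
  volume.withDensity fun Y => ENNReal.ofReal (p Y)

/-- Admissible source densities: probability densities with zero mean, finite second moments, and
a score function that has finite second moments. The density is differentiable in the weak
sense (integration by parts against test functions, `∂ p = - Φ p`), so that it may fail to be
smooth, as for the Laplace distribution, and it may vanish on some set. -/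
structure IsSourceDensity {K V : ℕ} (p : SCM K V → ℝ) : Prop where
  measurable : Measurable p
  nonneg : ∀ Y, 0 ≤ p Y
  lintegral_eq_one : ∫⁻ Y, ENNReal.ofReal (p Y) = 1
  memLp_entry : ∀ k v, MemLp (fun Y : SCM K V => Y k v) 2 (sourceLaw p)
  mean_zero : ∀ k v, ∫ Y, Y k v ∂(sourceLaw p) = 0
  memLp_score : ∀ k v, MemLp (fun Y => score p Y k v) 2 (sourceLaw p)
  integral_by_parts : ∀ k v (ξ : SCM K V → ℝ), ContDiff ℝ (⊤ : ℕ∞) ξ → HasCompactSupport ξ →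
    ∫ Y, p Y * fderiv ℝ ξ Y (entryDir k v) = ∫ Y, score p Y k v * p Y * ξ Y

/-- The sources `S n` are independent, and `S n` has the admissible density `p n`. No relation
between the samples (columns) or between the datasets (rows) of one source is imposed. -/
structure IsSourceModel {N K V : ℕ} {Ω : Type*} [MeasurableSpace Ω] (P : Measure Ω)
    (p : Fin N → SCM K V → ℝ) (S : Fin N → Ω → SCM K V) : Prop where
  density : ∀ n, IsSourceDensity (p n)
  hasLaw : ∀ n, HasLaw (S n) (sourceLaw (p n)) P
  indep : iIndepFun S P

/-- The linear mixture `X^[k] = A^[k] S^[k]`, where row `n` of the `N × V` matrix `S^[k]` is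
row `k` of the `n`-th source component matrix. -/
def mix {N K V : ℕ} (A : Fin K → Matrix (Fin N) (Fin N) ℝ) (s : Fin N → SCM K V) :
    Fin K → Fin N → Fin V → ℝ :=
  fun k i v => (A k * Matrix.of fun n w => s n k w) i v

/-- The distribution of the observations in the model with mixing matrices `A` and independent
sources with densities `p n`. -/
noncomputable def observationLaw {N K V : ℕ} (A : Fin K → Matrix (Fin N) (Fin N) ℝ)
    (p : Fin N → SCM K V → ℝ) : Measure (Fin K → Fin N → Fin V → ℝ) :=
  (Measure.pi fun n => sourceLaw (p n)).map (mix A)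

/-- The sources are identifiable from the observations `X = A S`: all mixing matrices `A'` that,
together with some independent sources, produce observations of the same distribution satisfy
`A'^[k] = A^[k] Λ^[k] P^[k]` with `Λ^[k]` nonsingular diagonal and `P^[k]` a permutation matrix. -/
def Identifiable {N K V : ℕ} {Ω : Type*} [MeasurableSpace Ω] (P : Measure Ω)
    (A : Fin K → Matrix (Fin N) (Fin N) ℝ) (S : Fin N → Ω → SCM K V) : Prop :=
  ∀ (A' : Fin K → Matrix (Fin N) (Fin N) ℝ) (p' : Fin N → SCM K V → ℝ),
    (∀ k, IsUnit (A' k).det) → (∀ n, IsSourceDensity (p' n)) →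
    observationLaw A' p' = P.map (fun ω => mix A fun n => S n ω) →
    ∀ k, ∃ (l : Fin N → ℝ) (σ : Equiv.Perm (Fin N)), (∀ n, l n ≠ 0) ∧
      A' k = A k * Matrix.diagonal l * σ.permMatrix ℝ

/-- The vectorization (stacked columns) of the rows of `s` that are listed in `α`. -/
def vecRows {K V : ℕ} (α : Finset (Fin K)) (s : SCM K V) : Fin V × α → ℝ :=
  Matrix.vec (Matrix.of fun (k : α) v => s k v)

/-- `R_α = E[vec_α(S) vec_α(S)ᵀ]`. -/
noncomputable def covRows {K V : ℕ} {Ω : Type*} [MeasurableSpace Ω] (P : Measure Ω)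
    (α : Finset (Fin K)) (S : Ω → SCM K V) : Matrix (Fin V × α) (Fin V × α) ℝ :=
  Matrix.of fun i j => ∫ ω, vecRows α (S ω) i * vecRows α (S ω) j ∂P

/-- `S` has an `α`-Gaussian component: the rows in `α` are independent of the other rows and follow
the normal distribution with mean zero and the nonsingular covariance matrix `R_α`. -/
structure HasGaussianComponent {K V : ℕ} {Ω : Type*} [MeasurableSpace Ω] (P : Measure Ω)
    (α : Finset (Fin K)) (S : Ω → SCM K V) : Prop where
  indep : IndepFun (fun ω => vecRows α (S ω)) (fun ω => vecRows αᶜ (S ω)) P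
  hasLaw : HasLaw (fun ω => WithLp.toLp 2 (vecRows α (S ω)))
    (multivariateGaussian 0 (covRows P α S)) P
  nonsingular : IsUnit (covRows P α S).det

/-- Two different sources share a nonempty index set `α` on which both have an `α`-Gaussian
component, with `R_{m,α} = (I_V ⊗ D) R_{n,α} (I_V ⊗ D)` for a nonsingular diagonal matrix `D`. -/
def HasMatchingGaussianPair {N K V : ℕ} {Ω : Type*} [MeasurableSpace Ω] (P : Measure Ω)
    (S : Fin N → Ω → SCM K V) : Prop :=
  ∃ α : Finset (Fin K), α.Nonempty ∧ ∃ m n : Fin N, m ≠ n ∧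
    HasGaussianComponent P α (S m) ∧ HasGaussianComponent P α (S n) ∧
    ∃ d : α → ℝ, (∀ k, d k ≠ 0) ∧
      covRows P α (S m) =
        ((1 : Matrix (Fin V) (Fin V) ℝ) ⊗ₖ Matrix.diagonal d) * covRows P α (S n) *
          ((1 : Matrix (Fin V) (Fin V) ℝ) ⊗ₖ Matrix.diagonal d)

/-- The random vector `(diag(Φ_m S_nᵀ), diag(Φ_n S_mᵀ))` of length `2K`. -/
noncomputable def pairVector {N K V : ℕ} {Ω : Type*} (p : Fin N → SCM K V → ℝ)
    (S : Fin N → Ω → SCM K V) (m n : Fin N) (ω : Ω) : Fin K ⊕ Fin K → ℝ :=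
  Sum.elim (score (p m) (S m ω) * (Matrix.of (S n ω))ᵀ).diag
    (score (p n) (S n ω) * (Matrix.of (S m ω))ᵀ).diag

/-- The `2K × 2K` block `F_{m,n}` of the Fisher information matrix of the demixing matrices, at
the solution: the covariance matrix of `(diag(Φ_m S_nᵀ), diag(Φ_n S_mᵀ))`. -/
noncomputable def fisherBlock {N K V : ℕ} {Ω : Type*} [MeasurableSpace Ω] (P : Measure Ω)
    (p : Fin N → SCM K V → ℝ) (S : Fin N → Ω → SCM K V) (m n : Fin N) :
    Matrix (Fin K ⊕ Fin K) (Fin K ⊕ Fin K) ℝ :=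
  Matrix.of fun i j =>
    covariance (fun ω => pairVector p S m n ω i) (fun ω => pairVector p S m n ω j) P

end IVA

/-! Everything is expressed through characteristic functions. The notion that links the three
conditions is `SplitsGaussian μ α`: the characteristic function of `μ` factors into a normal one in
the rows of `α` times its restriction to the other rows. For a centered law with finite second
moments and a density, this is equivalent to an `α`-Gaussian component, and the nonsingularity of
the covariance is automatic. To establish it, one needs that the covariance does not couple `α` to
its complement and that the logarithmic gradient of the characteristic function is linear in the
rows of `α`, as for a normal law; an ODE along a segment then gives the factorization
(`IsCenteredLaw.splitsGaussian`).

Fisher information. `pairVector` is centered, so a block is singular exactly if some nonzero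
combination of its entries, with weights `a` on the first half and `b` on the second, vanishes
almost surely. Testing this relation against products of entries turns scores into Kronecker deltas
through integration by parts and gives `a k * Rn + b l * Rm = 0` on the `(k, l)` covariance blocks.
Testing it against a character times an entry gives the linear logarithmic gradient. Both hold on a
level set of `a k * b k`, which serves as `α`. Conversely, on a normal factor the score is `R⁻¹`
applied to the source, and the relation between the two covariances makes an explicit combination
vanish identically.

Nonidentifiability yields a pair. Let `B k = (A k)⁻¹ * A' k`, with inverse `W k`, and suppose that
some column `i` of some `B k₀` has two nonzero entries, in rows `m` and `n`. Let `L` be the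
deviation of the logarithmic gradient of source `r` from its normal value. Passing to the other
sources, keeping only the component `i` (or all but `i`) and passing back multiplies row `k` of the
argument by `x k = W k i r * B k r i` (or by `1 - x k`), and it multiplies the `k`-th component of
`L` by the same number. Since `x` takes values in `[0, 1]` and `L` is `o(u)` at the origin, a
binomial averaging argument (`eq_zero_of_scaleRows`) forces `L = 0` in the rows with `0 < x k < 1`.
This is in the spirit of the Darmois–Skitovich theorem, but needs neither logarithms nor a
characteristic function without zeros. Intertwining of the covariances supplies the block structure
and the matrix `D`.

A pair yields nonidentifiability. After rescaling by `D` the two normal factors have the same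
covariance, so rotating them into each other leaves the joint law unchanged. The rotation is not
monomial, hence neither is the change in the mixing matrices. -/

namespace IVA

open Filter Topology Asymptotics

/-! ### Characters and centered laws on matrices -/

/-- The Euclidean pairing of two `K × V` matrices. -/
def pairing {K V : ℕ} (u x : SCM K V) : ℝ := ∑ k, ∑ v, u k v * x k v

/-- The character `x ↦ exp (i ⟨u, x⟩)`. -/
noncomputable def wave {K V : ℕ} (u x : SCM K V) : ℂ := Complex.exp (pairing u x * Complex.I)

/-- The characteristic function of a law on `K × V` matrices. -/
noncomputable def cf {K V : ℕ} (μ : Measure (SCM K V)) (u : SCM K V) : ℂ := ∫ x, wave u x ∂μ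

/-- The integral of `x k v * exp (i ⟨u, x⟩)`, a partial derivative of `cf` up to the factor `i`. -/
noncomputable def cfEntry {K V : ℕ} (μ : Measure (SCM K V)) (k : Fin K) (v : Fin V)
    (u : SCM K V) : ℂ := ∫ x, (x k v : ℂ) * wave u x ∂μ

/-- The second moment of two entries. -/
noncomputable def crossMoment {K V : ℕ} (μ : Measure (SCM K V)) (k : Fin K) (v : Fin V)
    (l : Fin K) (w : Fin V) : ℝ := ∫ x, x k v * x l w ∂μ

/-- Centered laws with finite second moments that charge no Lebesgue null set. -/
structure IsCenteredLaw {K V : ℕ} (μ : Measure (SCM K V)) : Prop where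
  isProb : IsProbabilityMeasure μ
  memLp : ∀ k v, MemLp (fun x : SCM K V => x k v) 2 μ
  mean_zero : ∀ k v, ∫ x, x k v ∂μ = 0
  absCont : μ ≪ volume

lemma IsSourceDensity.isProbabilityMeasure {K V : ℕ} {p : SCM K V → ℝ} (hp : IsSourceDensity p) :
    IsProbabilityMeasure (sourceLaw p) :=
  ⟨by rw [sourceLaw, withDensity_apply _ MeasurableSet.univ, Measure.restrict_univ,
    hp.lintegral_eq_one]⟩

lemma IsSourceDensity.isCenteredLaw {K V : ℕ} {p : SCM K V → ℝ} (hp : IsSourceDensity p) :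
    IsCenteredLaw (sourceLaw p) :=
  ⟨hp.isProbabilityMeasure, hp.memLp_entry, hp.mean_zero, withDensity_absolutelyContinuous _ _⟩

section pairing

variable {K V : ℕ}

lemma pairing_comm (u x : SCM K V) : pairing u x = pairing x u := by
  simp [pairing, mul_comm]

lemma pairing_add_left (u w x : SCM K V) : pairing (u + w) x = pairing u x + pairing w x := by
  simp [pairing, add_mul, Finset.sum_add_distrib]

lemma pairing_smul_left (c : ℝ) (u x : SCM K V) : pairing (c • u) x = c * pairing u x := by
  simp [pairing, Finset.mul_sum, mul_assoc]

lemma pairing_entryDir (k : Fin K) (v : Fin V) (x : SCM K V) :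
    pairing (entryDir k v) x = x k v := by
  simp [pairing, entryDir, Pi.single_apply, ite_apply]

lemma pairing_zero_left (x : SCM K V) : pairing 0 x = 0 := by simp [pairing]

lemma continuous_pairing (u : SCM K V) : Continuous (pairing u) := by
  unfold pairing; fun_prop

lemma abs_pairing_le (u x : SCM K V) : |pairing u x| ≤ ‖u‖ * ∑ k, ∑ v, |x k v| := by
  unfold pairing
  refine (Finset.abs_sum_le_sum_abs _ _).trans ?_
  rw [Finset.mul_sum]
  refine Finset.sum_le_sum fun k _ => (Finset.abs_sum_le_sum_abs _ _).trans ?_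
  rw [Finset.mul_sum]
  refine Finset.sum_le_sum fun v _ => ?_
  rw [abs_mul]
  gcongr
  exact (norm_le_pi_norm (u k) v).trans (norm_le_pi_norm u k)

lemma norm_wave (u x : SCM K V) : ‖wave u x‖ = 1 := Complex.norm_exp_ofReal_mul_I _

lemma continuous_wave (u : SCM K V) : Continuous (wave u) := by
  unfold wave
  have := continuous_pairing u
  fun_prop

lemma wave_zero (x : SCM K V) : wave 0 x = 1 := by simp [wave, pairing_zero_left]

/-- The part of `u` in the rows listed in `α`. -/
def onRows (α : Finset (Fin K)) (u : SCM K V) : SCM K V := fun k v => if k ∈ α then u k v else 0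

lemma onRows_add_compl (α : Finset (Fin K)) (u : SCM K V) : onRows α u + onRows αᶜ u = u := by
  ext k v
  by_cases h : k ∈ α <;> simp [onRows, h]

end pairing

namespace IsCenteredLaw

variable {K V : ℕ} {μ : Measure (SCM K V)}

lemma memLp_pairing (h : IsCenteredLaw μ) (u : SCM K V) : MemLp (pairing u) 2 μ :=
  memLp_finsetSum _ fun k _ => memLp_finsetSum _ fun v _ => (h.memLp k v).const_mul (u k v)

lemma memLp_wave (h : IsCenteredLaw μ) (u : SCM K V) : MemLp (wave u) 2 μ := by
  have := h.isProb
  exact MemLp.of_bound (continuous_wave u).aestronglyMeasurable 1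
    (Eventually.of_forall fun x => (norm_wave u x).le)

lemma integrable_wave (h : IsCenteredLaw μ) (u : SCM K V) : Integrable (wave u) μ := by
  have := h.isProb
  exact (h.memLp_wave u).integrable (by norm_num)

lemma integrable_mul (h : IsCenteredLaw μ) (k : Fin K) (v : Fin V) (l : Fin K) (w : Fin V) :
    Integrable (fun x : SCM K V => x k v * x l w) μ :=
  (h.memLp k v).integrable_mul (h.memLp l w)

lemma integrable_entry_mul_wave (h : IsCenteredLaw μ) (k : Fin K) (v : Fin V) (u : SCM K V) :
    Integrable (fun x : SCM K V => (x k v : ℂ) * wave u x) μ :=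
  ((h.memLp k v).ofReal (K := ℂ)).integrable_mul (h.memLp_wave u)

lemma cf_zero (h : IsCenteredLaw μ) : cf μ 0 = 1 := by
  have := h.isProb
  simp [cf, wave_zero]

lemma cfEntry_zero (h : IsCenteredLaw μ) (k : Fin K) (v : Fin V) : cfEntry μ k v 0 = 0 := by
  simp only [cfEntry, wave_zero, mul_one]
  rw [integral_complex_ofReal, h.mean_zero, Complex.ofReal_zero]

lemma crossMoment_symm (k : Fin K) (v : Fin V) (l : Fin K) (w : Fin V) :
    crossMoment μ k v l w = crossMoment μ l w k v := by
  simp [crossMoment, mul_comm]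

lemma integral_pairing_mul_pairing (h : IsCenteredLaw μ) (u w : SCM K V) :
    ∫ x, pairing u x * pairing w x ∂μ =
      ∑ k, ∑ v, ∑ l, ∑ z, u k v * w l z * crossMoment μ k v l z := by
  have key : ∀ x : SCM K V, pairing u x * pairing w x =
      ∑ k, ∑ v, ∑ l, ∑ z, u k v * w l z * (x k v * x l z) := by
    intro x
    simp only [pairing, Finset.sum_mul]
    simp only [Finset.mul_sum]
    refine Finset.sum_congr rfl fun k _ => Finset.sum_congr rfl fun v _ =>
      Finset.sum_congr rfl fun l _ => Finset.sum_congr rfl fun z _ => by ring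
  simp_rw [key]
  have I := fun k v l z => (h.integrable_mul k v l z).const_mul (u k v * w l z)
  rw [integral_finsetSum _ fun k _ => integrable_finsetSum _ fun v _ => integrable_finsetSum _
    fun l _ => integrable_finsetSum _ fun z _ => I k v l z]
  refine Finset.sum_congr rfl fun k _ => ?_
  rw [integral_finsetSum _ fun v _ => integrable_finsetSum _
    fun l _ => integrable_finsetSum _ fun z _ => I k v l z]
  refine Finset.sum_congr rfl fun v _ => ?_
  rw [integral_finsetSum _ fun l _ => integrable_finsetSum _ fun z _ => I k v l z]
  refine Finset.sum_congr rfl fun l _ => ?_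
  rw [integral_finsetSum _ fun z _ => I k v l z]
  refine Finset.sum_congr rfl fun z _ => ?_
  rw [integral_const_mul, crossMoment]

/-- The covariance form is positive definite. -/
lemma integral_pairing_sq_pos (h : IsCenteredLaw μ) {u : SCM K V} (hu : u ≠ 0) :
    0 < ∫ x, pairing u x ^ 2 ∂μ := by
  have := h.isProb
  have hint : Integrable (fun x => pairing u x ^ 2) μ := (h.memLp_pairing u).integrable_sq
  refine lt_of_le_of_ne (integral_nonneg fun x => sq_nonneg _) fun h0 => ?_
  have hae := (integral_eq_zero_iff_of_nonneg (fun x => sq_nonneg (pairing u x)) hint).1 h0.symm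
  let f : SCM K V →ₗ[ℝ] ℝ :=
    { toFun := pairing u
      map_add' := fun x y => by rw [pairing_comm, pairing_add_left, pairing_comm x, pairing_comm y]
      map_smul' := fun c x => by
        rw [pairing_comm, pairing_smul_left, pairing_comm x]; rfl }
  have hker : LinearMap.ker f ≠ ⊤ := by
    intro htop
    apply hu
    ext k v
    have : f u = 0 := by
      have : u ∈ LinearMap.ker f := htop ▸ Submodule.mem_top
      exact this
    change pairing u u = 0 at this
    unfold pairing at this
    rw [Finset.sum_eq_zero_iff_of_nonneg fun k _ => Finset.sum_nonneg fun v _ => mul_self_nonneg _]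
      at this
    have h2 := this k (Finset.mem_univ _)
    rw [Finset.sum_eq_zero_iff_of_nonneg fun v _ => mul_self_nonneg _] at h2
    simpa using h2 v (Finset.mem_univ _)
  -- A degenerate direction would confine the law to a proper subspace, which is Lebesgue null; this
  -- is where absolute continuity enters.
  have hnull : μ (LinearMap.ker f : Set (SCM K V)) = 0 :=
    h.absCont (Measure.addHaar_submodule volume _ hker)
  have hfull : ∀ᵐ x ∂μ, x ∈ (LinearMap.ker f : Set (SCM K V)) := by
    filter_upwards [hae] with x hx
    have : pairing u x ^ 2 = 0 := hx
    exact pow_eq_zero_iff (two_ne_zero) |>.1 this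
  have hfull' : ∀ᵐ x ∂μ, x ∉ (LinearMap.ker f : Set (SCM K V)) := measure_eq_zero_iff_ae_notMem.1 hnull
  obtain ⟨x, hx, hx'⟩ := (hfull.and hfull').exists
  exact hx' hx

lemma crossMoment_self_pos (h : IsCenteredLaw μ) (k : Fin K) (v : Fin V) :
    0 < crossMoment μ k v k v := by
  have := h.integral_pairing_sq_pos (u := entryDir k v) (by
    intro h0
    have := congrFun (congrFun h0 k) v
    simp [entryDir] at this)
  simpa [crossMoment, pairing_entryDir, sq] using this

end IsCenteredLaw

/-! ### Logarithmic gradient of the characteristic function near the origin -/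

/-- One row of the covariance operator. -/
noncomputable def covRow {K V : ℕ} (μ : Measure (SCM K V)) (k : Fin K) (v : Fin V)
    (u : SCM K V) : ℝ := ∑ l, ∑ z, crossMoment μ k v l z * u l z

/-- The deviation of the logarithmic derivative of the characteristic function from that of the
centered normal law with the same covariance, up to the factor `i`. -/
noncomputable def logDeviation {K V : ℕ} (μ : Measure (SCM K V)) (k : Fin K) (v : Fin V)
    (u : SCM K V) : ℂ := cfEntry μ k v u / cf μ u - Complex.I * covRow μ k v u

namespace IsCenteredLaw

variable {K V : ℕ} {μ : Measure (SCM K V)}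

lemma integral_entry_mul_pairing (h : IsCenteredLaw μ) (k : Fin K) (v : Fin V) (u : SCM K V) :
    ∫ x, x k v * pairing u x ∂μ = covRow μ k v u := by
  unfold covRow
  simp only [pairing, Finset.mul_sum]
  have I := fun l z => (h.integrable_mul k v l z).const_mul (u l z)
  have e : ∀ (x : SCM K V) l z, x k v * (u l z * x l z) = u l z * (x k v * x l z) :=
    fun x l z => by ring
  simp only [e]
  rw [integral_finsetSum _ fun l _ => integrable_finsetSum _ fun z _ => I l z]
  refine Finset.sum_congr rfl fun l _ => ?_
  rw [integral_finsetSum _ fun z _ => I l z]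
  refine Finset.sum_congr rfl fun z _ => ?_
  rw [integral_const_mul, crossMoment, mul_comm]

lemma integral_pairing_mul_pairing_eq (h : IsCenteredLaw μ) (u w : SCM K V) :
    ∫ x, pairing u x * pairing w x ∂μ = ∑ k, ∑ v, u k v * covRow μ k v w := by
  rw [h.integral_pairing_mul_pairing]
  simp only [covRow, Finset.mul_sum]
  refine Finset.sum_congr rfl fun k _ => Finset.sum_congr rfl fun v _ =>
      Finset.sum_congr rfl fun l _ => Finset.sum_congr rfl fun z _ => by ring

lemma continuous_cf (h : IsCenteredLaw μ) : Continuous (cf μ) := by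
  have := h.isProb
  unfold cf
  refine continuous_of_dominated (bound := fun _ => 1)
    (fun u => (continuous_wave u).aestronglyMeasurable)
    (fun u => Eventually.of_forall fun x => (norm_wave u x).le) (integrable_const _)
    (Eventually.of_forall fun x => ?_)
  unfold wave pairing
  fun_prop

lemma integral_pairing_mul_wave (h : IsCenteredLaw μ) (w u : SCM K V) :
    ∫ x, (pairing w x : ℂ) * wave u x ∂μ = ∑ k, ∑ v, (w k v : ℂ) * cfEntry μ k v u := by
  have e : ∀ x : SCM K V, (pairing w x : ℂ) * wave u x =
      ∑ k, ∑ v, (w k v : ℂ) * ((x k v : ℂ) * wave u x) := by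
    intro x
    simp [pairing, Finset.sum_mul, mul_assoc]
  have I := fun k v => (h.integrable_entry_mul_wave k v u).const_mul (w k v : ℂ)
  simp only [e]
  rw [integral_finsetSum _ fun k _ => integrable_finsetSum _ fun v _ => I k v]
  refine Finset.sum_congr rfl fun k _ => ?_
  rw [integral_finsetSum _ fun v _ => I k v]
  exact Finset.sum_congr rfl fun v _ => integral_const_mul _ _

lemma hasDerivAt_cf (h : IsCenteredLaw μ) (u w : SCM K V) (s : ℝ) :
    HasDerivAt (fun s : ℝ => cf μ (u + s • w))
      (Complex.I * ∑ k, ∑ v, (w k v : ℂ) * cfEntry μ k v (u + s • w)) s := by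
  have := h.isProb
  have hw : ∀ (t : ℝ) x, wave (u + t • w) x =
      Complex.exp (((pairing u x : ℝ) + t * (pairing w x : ℝ) : ℂ) * Complex.I) := by
    intro t x
    simp [wave, pairing_add_left, pairing_smul_left]
  have key := (hasDerivAt_integral_of_dominated_loc_of_deriv_le (μ := μ) (s := Set.univ) (x₀ := s)
    (F := fun (t : ℝ) x => wave (u + t • w) x) (bound := fun x => ‖pairing w x‖)
    (F' := fun t x => Complex.I * ((pairing w x : ℂ) * wave (u + t • w) x)) univ_mem
    (Eventually.of_forall fun t => (continuous_wave _).aestronglyMeasurable)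
    (h.integrable_wave _)
    ((continuous_const.mul ((Complex.continuous_ofReal.comp (continuous_pairing w)).mul
      (continuous_wave _))).aestronglyMeasurable)
    (Eventually.of_forall fun x t _ => by simp [norm_wave])
    ((h.memLp_pairing w).integrable (by norm_num)).norm
    (Eventually.of_forall fun x t _ => by
      simp only [hw]
      have h1 : HasDerivAt (fun t : ℝ => ((pairing u x : ℝ) + t * (pairing w x : ℝ) : ℂ) *
          Complex.I) ((pairing w x : ℂ) * Complex.I) t := by
        have := ((Complex.ofRealCLM.hasDerivAt (x := t)).mul_const (pairing w x : ℂ)).const_add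
          (pairing u x : ℂ) |>.mul_const Complex.I
        simpa using this
      exact h1.cexp.congr_deriv (by ring))).2
  refine key.congr_deriv ?_
  rw [integral_const_mul, h.integral_pairing_mul_wave]

/-- `pairing` as a continuous linear form in its first argument. -/
noncomputable def pairingCLM (x : SCM K V) : SCM K V →L[ℝ] ℝ :=
  LinearMap.toContinuousLinearMap
    { toFun := fun u => pairing u x
      map_add' := fun u w => pairing_add_left u w x
      map_smul' := fun c u => pairing_smul_left c u x }

lemma pairingCLM_apply (x u : SCM K V) : pairingCLM x u = pairing u x := rfl

lemma norm_pairingCLM_le (x : SCM K V) : ‖pairingCLM x‖ ≤ ∑ k, ∑ v, |x k v| :=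
  ContinuousLinearMap.opNorm_le_bound _
    (Finset.sum_nonneg fun _ _ => Finset.sum_nonneg fun _ _ => abs_nonneg _) fun u => by
      rw [pairingCLM_apply, mul_comm]
      exact abs_pairing_le u x

/-- Differentiation under the integral at the origin, dominated by `|x k v| * ∑ |x l z|`, which is
integrable because of finite second moments. The value at the origin is zero by centering, and the
derivative is `I` times the covariance row. -/
lemma cfEntry_sub_isLittleO (h : IsCenteredLaw μ) (k : Fin K) (v : Fin V) :
    (fun u => cfEntry μ k v u - Complex.I * covRow μ k v u) =o[𝓝 0] (fun u : SCM K V => u) := by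
  have := h.isProb
  have hB : Integrable (fun x : SCM K V => |x k v| * ∑ l, ∑ z, |x l z|) μ := by
    simp only [Finset.mul_sum, ← abs_mul]
    exact integrable_finsetSum _ fun l _ => integrable_finsetSum _ fun z _ =>
      (h.integrable_mul k v l z).abs
  have hc : Continuous fun x : SCM K V => pairingCLM x := by
    refine continuous_clm_apply.2 fun u => ?_
    simpa only [pairingCLM_apply] using continuous_pairing u
  have hmeas : ∀ u : SCM K V, AEStronglyMeasurable (fun x : SCM K V =>
      ((x k v : ℂ) * wave u x * Complex.I) • Complex.ofRealCLM.comp (pairingCLM x)) μ := by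
    intro u
    have := continuous_wave u
    exact Continuous.aestronglyMeasurable (by fun_prop)
  have hbd : ∀ u x : SCM K V, ‖((x k v : ℂ) * wave u x * Complex.I) •
      Complex.ofRealCLM.comp (pairingCLM x)‖ ≤ |x k v| * ∑ l, ∑ z, |x l z| := by
    intro u x
    rw [norm_smul]
    simp only [norm_mul, norm_wave, Complex.norm_I, mul_one, Complex.norm_real, Real.norm_eq_abs]
    gcongr
    refine (ContinuousLinearMap.opNorm_comp_le _ _).trans ?_
    rw [Complex.ofRealCLM_norm, one_mul]
    exact norm_pairingCLM_le x
  have key := hasFDerivAt_integral_of_dominated_of_fderiv_le (μ := μ) (s := Set.univ)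
    (x₀ := (0 : SCM K V)) (F := fun u x => (x k v : ℂ) * wave u x)
    (bound := fun x => |x k v| * ∑ l, ∑ z, |x l z|)
    (F' := fun u x => ((x k v : ℂ) * wave u x * Complex.I) •
      Complex.ofRealCLM.comp (pairingCLM x)) univ_mem
    (Eventually.of_forall fun u => (h.integrable_entry_mul_wave k v u).aestronglyMeasurable)
    (h.integrable_entry_mul_wave k v 0) (hmeas 0)
    (Eventually.of_forall fun x u _ => hbd u x) hB
    (Eventually.of_forall fun x u _ => by
      have h1 : HasFDerivAt (fun u : SCM K V => (pairing u x : ℂ) * Complex.I)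
          (Complex.I • Complex.ofRealCLM.comp (pairingCLM x)) u := by
        have := (Complex.ofRealCLM.comp (pairingCLM x)).hasFDerivAt (x := u) |>.mul_const' Complex.I
        exact this.congr_fderiv (ContinuousLinearMap.ext fun z => by simp)
      have h2 := (h1.cexp).const_mul (x k v : ℂ)
      exact h2.congr_fderiv (ContinuousLinearMap.ext fun z => by simp [wave, mul_assoc]))
  have hlin : ∀ u, (∫ x : SCM K V, ((x k v : ℂ) * wave 0 x * Complex.I) •
      Complex.ofRealCLM.comp (pairingCLM x) ∂μ) u = Complex.I * covRow μ k v u := by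
    intro u
    rw [ContinuousLinearMap.integral_apply (hB.mono' (hmeas 0) (Eventually.of_forall (hbd 0))),
      ← h.integral_entry_mul_pairing, ← integral_complex_ofReal, ← integral_const_mul]
    refine integral_congr_ae (Eventually.of_forall fun x => ?_)
    simp [wave_zero, pairingCLM_apply]
    ring
  have := key.isLittleO
  simp only [hlin, sub_zero] at this
  refine this.congr_left fun u => ?_
  rw [← cfEntry, ← cfEntry, h.cfEntry_zero, sub_zero]

lemma covRow_isBigO (k : Fin K) (v : Fin V) :
    (fun u => Complex.I * (covRow μ k v u : ℂ)) =O[𝓝 0] (fun u : SCM K V => u) := by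
  refine IsBigO.of_bound (∑ l, ∑ z, |crossMoment μ k v l z|) (Eventually.of_forall fun u => ?_)
  have := abs_pairing_le u (fun l z => crossMoment μ k v l z)
  rw [pairing_comm] at this
  have e : ‖Complex.I * (covRow μ k v u : ℂ)‖ = |covRow μ k v u| := by simp
  rw [e]
  simpa only [mul_comm, covRow, pairing] using this

/-- This is the first-order vanishing required in `eq_zero_of_scaleRows`; dividing by the
characteristic function is harmless since it tends to one. -/
lemma logDeviation_isLittleO (h : IsCenteredLaw μ) (k : Fin K) (v : Fin V) :
    logDeviation μ k v =o[𝓝 0] (fun u : SCM K V => u) := by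
  have hcf : Tendsto (cf μ) (𝓝 0) (𝓝 1) := by
    simpa [h.cf_zero] using h.continuous_cf.tendsto 0
  have hinv : (fun u => (cf μ u)⁻¹) =O[𝓝 0] (fun _ => (1 : ℝ)) := by
    have := hcf.inv₀ one_ne_zero
    exact this.isBigO_one ℝ
  have hone : (fun u => 1 - cf μ u) =o[𝓝 0] (fun _ => (1 : ℝ)) := by
    rw [isLittleO_one_iff]
    simpa using hcf.const_sub 1
  -- The numerator `cfEntry - I R u * cf` is split as `(cfEntry - I R u) + I R u * (1 - cf)`; the
  -- second summand is `O(u)` times `o(1)`.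
  have h1 := ((h.cfEntry_sub_isLittleO k v).norm_right.add
    (by simpa using (covRow_isBigO (μ := μ) k v).norm_right.mul_isLittleO hone))
  have h2 := (h1.mul_isBigO hinv)
  refine IsLittleO.of_norm_right ?_
  refine (h2.congr' ?_ ?_)
  · have : ∀ᶠ u in 𝓝 (0 : SCM K V), cf μ u ≠ 0 := hcf.eventually_ne one_ne_zero
    filter_upwards [this] with u hu
    unfold logDeviation
    field_simp
    ring
  · simp

end IsCenteredLaw

/-! ### The functional equation under complementary row contractions -/

lemma le_choose_of_pos_of_lt {r j : ℕ} (hj : 0 < j) (hjr : j < r) : r ≤ r.choose j := by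
  induction r with
  | zero => omega
  | succ r ih =>
    obtain ⟨i, rfl⟩ : ∃ i, j = i + 1 := ⟨j - 1, by omega⟩
    rw [Nat.choose_succ_succ']
    have h1 : 0 < r.choose i := Nat.choose_pos (by omega)
    rcases Nat.lt_or_ge (i + 1) r with h | h
    · have := ih h
      omega
    · obtain rfl : r = i + 1 := by omega
      simp

lemma sum_binomial_eq_one (x : ℝ) (r : ℕ) :
    ∑ j ∈ Finset.range (r + 1), x ^ j * (1 - x) ^ (r - j) * (r.choose j : ℝ) = 1 := by
  rw [← add_pow]
  simp

lemma binomial_nonneg {x : ℝ} (h0 : 0 ≤ x) (h1 : x ≤ 1) (r j : ℕ) :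
    0 ≤ x ^ j * (1 - x) ^ (r - j) :=
  mul_nonneg (pow_nonneg h0 _) (pow_nonneg (by linarith) _)

/-- A single binomial probability is at most one and its coefficient is at least `r`. The bound is
uniform in `x`, including `x = 0` and `x = 1`, so mixed products of `x` and `1 - x` contract every
row at once, which powers of `x` alone do not. -/
lemma pow_mul_pow_le_inv {x : ℝ} (h0 : 0 ≤ x) (h1 : x ≤ 1) {r j : ℕ} (hj : 0 < j) (hjr : j < r) :
    x ^ j * (1 - x) ^ (r - j) ≤ 1 / r := by
  have hr : (0 : ℝ) < r := by exact_mod_cast hj.trans hjr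
  have hsum := sum_binomial_eq_one x r
  have hle : x ^ j * (1 - x) ^ (r - j) * (r.choose j : ℝ) ≤ 1 := by
    refine le_of_le_of_eq ?_ hsum
    exact Finset.single_le_sum (f := fun j => x ^ j * (1 - x) ^ (r - j) * (r.choose j : ℝ))
      (fun i _ => mul_nonneg (binomial_nonneg h0 h1 r i) (Nat.cast_nonneg _))
      (Finset.mem_range.2 (by omega))
  have hc : (r : ℝ) ≤ r.choose j := by exact_mod_cast le_choose_of_pos_of_lt hj hjr
  rw [le_div_iff₀ hr]
  exact (mul_le_mul_of_nonneg_left hc (binomial_nonneg h0 h1 r j)).trans hle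

/-- Multiplication of the rows of a matrix by scalars. -/
def scaleRows {K V : ℕ} (x : Fin K → ℝ) (u : SCM K V) : SCM K V := fun k v => x k * u k v

section scale

variable {K V : ℕ}

lemma scaleRows_scaleRows (x y : Fin K → ℝ) (u : SCM K V) :
    scaleRows x (scaleRows y u) = scaleRows (x * y) u := by
  ext k v
  simp [scaleRows, mul_assoc]

lemma norm_le_sum_abs (u : SCM K V) : ‖u‖ ≤ ∑ k, ∑ v, |u k v| := by
  have hn : ∀ k, 0 ≤ ∑ v, |u k v| := fun k => Finset.sum_nonneg fun v _ => abs_nonneg _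
  refine (pi_norm_le_iff_of_nonneg (Finset.sum_nonneg fun k _ => hn k)).2 fun k => ?_
  refine (pi_norm_le_iff_of_nonneg (Finset.sum_nonneg fun k _ => hn k)).2 fun v => ?_
  exact (Finset.single_le_sum (f := fun v => |u k v|) (fun v _ => abs_nonneg _)
    (Finset.mem_univ v)).trans
    (Finset.single_le_sum (f := fun k => ∑ v, |u k v|) (fun k _ => hn k) (Finset.mem_univ k))

/-- A function that is multiplied by `q` and `1 - q` under two complementary row contractions, and
that vanishes to first order at the origin, is zero. -/
lemma eq_zero_of_scaleRows {L : SCM K V → ℂ} {U : Set (SCM K V)} {x : Fin K → ℝ} {q : ℝ}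
    (hx0 : ∀ k, 0 ≤ x k) (hx1 : ∀ k, x k ≤ 1) (hq0 : 0 < q) (hq1 : q < 1)
    (hL0 : L =o[𝓝 0] fun u : SCM K V => u)
    (hU : ∀ u ∈ U, scaleRows x u ∈ U ∧ L (scaleRows x u) = q * L u)
    (hU' : ∀ u ∈ U, scaleRows (1 - x) u ∈ U ∧ L (scaleRows (1 - x) u) = (1 - q : ℝ) * L u)
    {u : SCM K V} (hu : u ∈ U) : L u = 0 := by
  have hpow : ∀ (y : Fin K → ℝ) (c : ℝ),
      (∀ u ∈ U, scaleRows y u ∈ U ∧ L (scaleRows y u) = c * L u) → ∀ (a : ℕ), ∀ u ∈ U,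
      scaleRows (y ^ a) u ∈ U ∧ L (scaleRows (y ^ a) u) = (c ^ a : ℝ) * L u := by
    intro y c hy a
    induction a with
    | zero =>
      intro u hu
      have : scaleRows (y ^ 0) u = u := by ext; simp [scaleRows]
      rw [this]
      simp [hu]
    | succ a ih =>
      intro u hu
      rw [pow_succ', ← scaleRows_scaleRows]
      refine ⟨(hy _ (ih u hu).1).1, ?_⟩
      rw [(hy _ (ih u hu).1).2, (ih u hu).2]
      push_cast
      ring
  -- `w r j` is the result of `j` contractions by `x` and `r - j` by `1 - x`; weighted with
  -- `r.choose j`, these vectors form a binomial partition of `u`.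
  set w : ℕ → ℕ → SCM K V := fun r j => scaleRows (x ^ j * (1 - x) ^ (r - j)) u with hw
  have hLw : ∀ r j, L (w r j) = (q ^ j * (1 - q) ^ (r - j) : ℝ) * L u := by
    intro r j
    have h1 := hpow _ _ hU' (r - j) u hu
    have h2 := hpow _ _ hU j _ h1.1
    rw [hw]
    simp only
    rw [← scaleRows_scaleRows, h2.2, h1.2]
    push_cast
    ring
  set n1 : ℝ := ∑ k, ∑ v, |u k v| with hn1
  have hn1nn : 0 ≤ n1 := Finset.sum_nonneg fun k _ => Finset.sum_nonneg fun v _ => abs_nonneg _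
  have hwabs : ∀ r j k v, |w r j k v| = x k ^ j * (1 - x k) ^ (r - j) * |u k v| := by
    intro r j k v
    simp only [hw, scaleRows, abs_mul, Pi.mul_apply, Pi.pow_apply, Pi.sub_apply, Pi.one_apply]
    rw [abs_of_nonneg (pow_nonneg (hx0 k) _),
      abs_of_nonneg (pow_nonneg (sub_nonneg.2 (hx1 k)) _)]
  by_contra hne
  have hLpos : 0 < ‖L u‖ := norm_pos_iff.2 hne
  -- Chosen to contradict the final estimate `‖L u‖ * (2 * q * (1 - q)) ≤ ε * n1`; the `+ 1` makes
  -- the inequality strict and covers `n1 = 0`.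
  set ε : ℝ := ‖L u‖ * (2 * q * (1 - q)) / (n1 + 1) with hε
  have hεpos : 0 < ε := by
    have : 0 < 1 - q := by linarith
    positivity
  obtain ⟨δ, hδ, hball⟩ := Metric.eventually_nhds_iff.1 (hL0.def hεpos)
  -- For `0 < j < r` the vector `w r j` has norm at most `n1 / r`, so this `r` puts all of them into
  -- the ball where `‖L‖ ≤ ε ‖·‖`.
  obtain ⟨r, hr⟩ := exists_nat_gt (max 2 (n1 / δ))
  have hr2 : 2 < r := by exact_mod_cast (le_max_left _ _).trans_lt hr
  have hrpos : (0 : ℝ) < r := by exact_mod_cast (by omega : 0 < r)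
  have hrδ : n1 / r < δ := by
    rw [div_lt_iff₀ hrpos, mul_comm]
    exact (div_lt_iff₀ hδ).1 ((le_max_right _ _).trans_lt hr)
  have hwsum : ∀ j, ‖w r j‖ ≤ ∑ k, ∑ v, x k ^ j * (1 - x k) ^ (r - j) * |u k v| := by
    intro j
    refine (norm_le_sum_abs _).trans_eq ?_
    simp only [hwabs]
  have hsmall : ∀ j, 0 < j → j < r → ‖L (w r j)‖ ≤ ε * ‖w r j‖ := by
    intro j hj hjr
    refine hball ?_
    rw [dist_zero_right]
    refine ((hwsum j).trans ?_).trans_lt hrδ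
    rw [hn1, Finset.sum_div]
    refine Finset.sum_le_sum fun k _ => ?_
    rw [Finset.sum_div]
    refine Finset.sum_le_sum fun v _ => ?_
    have := pow_mul_pow_le_inv (hx0 k) (hx1 k) hj hjr
    calc _ ≤ 1 / (r : ℝ) * |u k v| := by gcongr
      _ = _ := by ring
  -- The terms `j = 0` and `j = r` are dropped, because rows with `x k = 0` or `x k = 1` are not
  -- contracted there. Since `0 < q < 1`, the remaining terms still carry mass at least `1 - q ^ 2 -
  -- (1 - q) ^ 2 = 2 * q * (1 - q)` for `q`.
  have hmid : ∀ y : ℝ, ∑ j ∈ Finset.Ico 1 r, y ^ j * (1 - y) ^ (r - j) * (r.choose j : ℝ) =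
      1 - y ^ r - (1 - y) ^ r := by
    intro y
    have h := sum_binomial_eq_one y r
    rw [Finset.sum_range_succ, Finset.range_eq_Ico, Finset.sum_eq_sum_Ico_succ_bot (by omega)] at h
    simp at h
    linarith
  have hlow : 2 * q * (1 - q) ≤ 1 - q ^ r - (1 - q) ^ r := by
    have h1 : q ^ r ≤ q ^ 2 := pow_le_pow_of_le_one hq0.le hq1.le hr2.le
    have h2 : (1 - q) ^ r ≤ (1 - q) ^ 2 :=
      pow_le_pow_of_le_one (by linarith) (by linarith) hr2.le
    nlinarith
  -- The binomially weighted sum of `‖L (w r j)‖` is computed exactly by the eigenvalue relation and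
  -- bounded by `ε` times the weighted sum of the ℓ¹ norms of the `w r j`, which is at most `n1`,
  -- entry by entry.
  have hmain : ‖L u‖ * (1 - q ^ r - (1 - q) ^ r) ≤ ε * n1 := by
    rw [← hmid q, Finset.mul_sum]
    calc ∑ j ∈ Finset.Ico 1 r, ‖L u‖ * (q ^ j * (1 - q) ^ (r - j) * (r.choose j : ℝ))
        = ∑ j ∈ Finset.Ico 1 r, ‖L (w r j)‖ * (r.choose j : ℝ) := by
          refine Finset.sum_congr rfl fun j _ => ?_
          rw [hLw, norm_mul, Complex.norm_real,
            Real.norm_of_nonneg (binomial_nonneg hq0.le hq1.le r j)]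
          ring
      _ ≤ ∑ j ∈ Finset.Ico 1 r,
          ε * (∑ k, ∑ v, x k ^ j * (1 - x k) ^ (r - j) * |u k v|) * (r.choose j : ℝ) := by
          refine Finset.sum_le_sum fun j hj => ?_
          obtain ⟨h1, h2⟩ := Finset.mem_Ico.1 hj
          gcongr
          exact (hsmall j h1 h2).trans (by gcongr; exact hwsum j)
      _ = ε * ∑ k, ∑ v, (∑ j ∈ Finset.Ico 1 r,
          x k ^ j * (1 - x k) ^ (r - j) * (r.choose j : ℝ)) * |u k v| := by
          simp only [Finset.mul_sum, Finset.sum_mul]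
          rw [Finset.sum_comm]
          refine Finset.sum_congr rfl fun k _ => ?_
          rw [Finset.sum_comm]
          refine Finset.sum_congr rfl fun v _ => Finset.sum_congr rfl fun j _ => by ring
      _ ≤ ε * n1 := by
          refine mul_le_mul_of_nonneg_left ?_ hεpos.le
          refine Finset.sum_le_sum fun k _ => Finset.sum_le_sum fun v _ => ?_
          refine mul_le_of_le_one_left (abs_nonneg _) ?_
          rw [hmid]
          have h1 := pow_nonneg (hx0 k) r
          have h2 := pow_nonneg (sub_nonneg.2 (hx1 k)) r
          linarith
  have hfin : ε * n1 < ‖L u‖ * (2 * q * (1 - q)) := by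
    have : ε * (n1 + 1) = ‖L u‖ * (2 * q * (1 - q)) := by
      rw [hε]
      field_simp
    linarith
  have := mul_le_mul_of_nonneg_left hlow hLpos.le
  linarith

end scale

/-! ### From a linear logarithmic gradient to a normal factor -/

/-- A nonvanishing solution of `f' = - s c f` on the line is a Gaussian; zeros are not attained in
finite time. -/
lemma eq_gaussian_of_hasDerivAt {f g : ℝ → ℂ} {c : ℝ} (hf : ∀ s, HasDerivAt f (g s) s)
    (hg : ∀ s, f s ≠ 0 → g s = -(s * c : ℝ) * f s) :
    f 1 = Complex.exp (-(c : ℂ) / 2) * f 0 := by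
  set h : ℝ → ℂ := fun s => f s * Complex.exp ((s ^ 2 * c / 2 : ℝ)) with hh
  have hE : ∀ s : ℝ, HasDerivAt (fun s : ℝ => Complex.exp ((s ^ 2 * c / 2 : ℝ)))
      (Complex.exp ((s ^ 2 * c / 2 : ℝ)) * (s * c : ℝ)) s := by
    intro s
    have h1 : HasDerivAt (fun s : ℝ => s ^ 2 * c / 2) (s * c) s :=
      (((hasDerivAt_pow 2 s).mul_const c).div_const 2).congr_deriv (by simp; ring)
    exact h1.ofReal_comp.cexp
  have hd : ∀ s, HasDerivAt h (g s * Complex.exp ((s ^ 2 * c / 2 : ℝ)) +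
      f s * (Complex.exp ((s ^ 2 * c / 2 : ℝ)) * (s * c : ℝ))) s := fun s => (hf s).mul (hE s)
  have hd0 : ∀ s, f s ≠ 0 → HasDerivAt h 0 s := by
    intro s hs
    refine (hd s).congr_deriv ?_
    rw [hg s hs]
    ring
  -- The equation is known only where `f ≠ 0`. The derivative of the square, `2 * h * h'`, vanishes
  -- at the zeros of `f` as well, so `h ^ 2` is constant without any continuation argument.
  have hsq : ∀ s, HasDerivAt (fun s => h s ^ 2) 0 s := by
    intro s
    by_cases hs : f s = 0
    · refine ((hd s).pow 2).congr_deriv ?_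
      simp [hh, hs]
    · refine ((hd0 s hs).pow 2).congr_deriv ?_
      simp
  have hconst : ∀ s, h s ^ 2 = h 0 ^ 2 := fun s =>
    is_const_of_deriv_eq_zero (fun s => (hsq s).differentiableAt) (fun s => (hsq s).deriv) s 0
  have hzero : ∀ s, h s = 0 ↔ f s = 0 := fun s => by simp [hh]
  have hfin : h 1 = h 0 := by
    by_cases h0 : h 0 = 0
    · have := hconst 1
      rw [h0, zero_pow two_ne_zero, pow_eq_zero_iff two_ne_zero] at this
      rw [this, h0]
    · have hne : ∀ s, f s ≠ 0 := by
        intro s hs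
        have := hconst s
        rw [(hzero s).2 hs, zero_pow two_ne_zero, eq_comm, pow_eq_zero_iff two_ne_zero] at this
        exact h0 this
      exact is_const_of_deriv_eq_zero (fun s => (hd0 s (hne s)).differentiableAt)
        (fun s => (hd0 s (hne s)).deriv) 1 0
  simp only [hh, one_pow, one_mul, ne_eq, OfNat.ofNat_ne_zero, not_false_eq_true, zero_pow,
    zero_mul, zero_div, Complex.ofReal_zero, Complex.exp_zero, mul_one] at hfin
  rw [← hfin, mul_left_comm, ← Complex.exp_add]
  push_cast
  ring_nf
  simp

/-- The rows in `α` split off as an independent normal factor, in terms of characteristic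
functions. -/
def SplitsGaussian {K V : ℕ} (μ : Measure (SCM K V)) (α : Finset (Fin K)) : Prop :=
  ∀ u, cf μ u = Complex.exp (-((∫ x, pairing (onRows α u) x ^ 2 ∂μ : ℝ) : ℂ) / 2) *
    cf μ (onRows αᶜ u)

/-- On the segment from `onRows αᶜ u` to `u` the characteristic function solves `f' = - s c f`,
where `c` is the variance in the direction `onRows α u`. The vanishing cross moments ensure that the
part of `u` outside `α` contributes nothing to the covariance rows in `α`. -/
lemma IsCenteredLaw.splitsGaussian {K V : ℕ} {μ : Measure (SCM K V)} (h : IsCenteredLaw μ)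
    {α : Finset (Fin K)} (hcross : ∀ k ∈ α, ∀ l ∉ α, ∀ v w, crossMoment μ k v l w = 0)
    (hdev : ∀ k ∈ α, ∀ v u, cf μ u ≠ 0 → cfEntry μ k v u = Complex.I * covRow μ k v u * cf μ u) :
    SplitsGaussian μ α := by
  intro u
  set w := onRows α u with hw
  set u' := onRows αᶜ u with hu'
  have hk0 : ∀ k ∉ α, ∀ v, w k v = 0 := fun k hk v => by simp [hw, onRows, hk]
  have hrow : ∀ k ∈ α, ∀ v (s : ℝ), covRow μ k v (u' + s • w) = s * covRow μ k v w := by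
    intro k hk v s
    simp only [covRow, Finset.mul_sum]
    refine Finset.sum_congr rfl fun l _ => Finset.sum_congr rfl fun z _ => ?_
    by_cases hl : l ∈ α
    · simp [hu', onRows, hl]
      ring
    · simp [hcross k hk l hl]
  have hq : ∫ x, pairing w x ^ 2 ∂μ = ∑ k, ∑ v, w k v * covRow μ k v w := by
    simp only [sq]
    exact h.integral_pairing_mul_pairing_eq w w
  have key := eq_gaussian_of_hasDerivAt (f := fun s : ℝ => cf μ (u' + s • w))
    (c := ∫ x, pairing w x ^ 2 ∂μ) (fun s => h.hasDerivAt_cf u' w s) (by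
      intro s hs
      rw [hq]
      push_cast
      rw [neg_mul, Finset.mul_sum, Finset.mul_sum, Finset.sum_mul, ← Finset.sum_neg_distrib]
      refine Finset.sum_congr rfl fun k _ => ?_
      rw [Finset.mul_sum, Finset.mul_sum, Finset.sum_mul, ← Finset.sum_neg_distrib]
      refine Finset.sum_congr rfl fun v _ => ?_
      by_cases hk : k ∈ α
      · rw [hdev k hk v _ hs, hrow k hk]
        push_cast
        linear_combination ((w k v : ℂ) * s * covRow μ k v w * cf μ (u' + s • w)) *
          Complex.I_mul_I
      · simp [hk0 k hk])
  have e : u' + w = u := by rw [add_comm, hw, hu', onRows_add_compl]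
  simpa [e] using key

lemma IsCenteredLaw.cfEntry_of_logDeviation_eq_zero {K V : ℕ} {μ : Measure (SCM K V)} {k : Fin K}
    {v : Fin V} {u : SCM K V} (hu : cf μ u ≠ 0) (hdev : logDeviation μ k v u = 0) :
    cfEntry μ k v u = Complex.I * covRow μ k v u * cf μ u := by
  rw [logDeviation, sub_eq_zero, div_eq_iff hu] at hdev
  exact hdev

/-! ### Gaussian components in terms of characteristic functions -/

section gaussianComponent

variable {K V : ℕ} {Ω : Type*} [MeasurableSpace Ω] {P : Measure Ω} {μ : Measure (SCM K V)}
  {S : Ω → SCM K V} {α : Finset (Fin K)}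

lemma integral_comp_eq {E : Type*} [NormedAddCommGroup E] [NormedSpace ℝ E]
    (hS : HasLaw S μ P) {f : SCM K V → E} (hf : AEStronglyMeasurable f μ) :
    ∫ ω, f (S ω) ∂P = ∫ x, f x ∂μ :=
  hS.integral_comp hf

/-- Extension by zero of a vector indexed by the entries of the rows in `α`. -/
def extendRows (α : Finset (Fin K)) (t : Fin V × α → ℝ) : SCM K V :=
  fun k v => if h : k ∈ α then t (v, ⟨k, h⟩) else 0

lemma vecRows_apply (s : SCM K V) (i : Fin V × α) : vecRows α s i = s i.2 i.1 := rfl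

lemma pairing_extendRows (t : Fin V × α → ℝ) (s : SCM K V) :
    pairing (extendRows α t) s = ∑ i, t i * vecRows α s i := by
  rw [Fintype.sum_prod_type_right]
  unfold pairing
  rw [← Finset.sum_subset (Finset.subset_univ α)
    (fun k _ hk => by simp [extendRows, hk]), ← Finset.sum_coe_sort α]
  simp [extendRows, vecRows_apply]

lemma onRows_extendRows (t : Fin V × α → ℝ) : onRows α (extendRows α t) = extendRows α t := by
  ext k v
  by_cases h : k ∈ α <;> simp [onRows, extendRows, h]

lemma onRows_compl_extendRows (t : Fin V × α → ℝ) : onRows αᶜ (extendRows α t) = 0 := by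
  ext k v
  by_cases h : k ∈ α <;> simp [onRows, extendRows, h]

lemma extendRows_vecRows (u : SCM K V) : extendRows α (vecRows α u) = onRows α u := by
  ext k v
  by_cases h : k ∈ α <;> simp [onRows, extendRows, h, vecRows_apply]

lemma extendRows_eq_zero_iff {t : Fin V × α → ℝ} : extendRows α t = 0 ↔ t = 0 := by
  refine ⟨fun h => ?_, fun h => by ext; simp [h, extendRows]⟩
  ext ⟨v, k, hk⟩
  simpa [extendRows, hk] using congrFun (congrFun h k) v

lemma continuous_vecRows : Continuous (vecRows α : SCM K V → Fin V × α → ℝ) :=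
  continuous_pi fun i => (continuous_apply i.1).comp (continuous_apply (i.2 : Fin K))

lemma covRows_apply (hS : HasLaw S μ P) (i j : Fin V × α) :
    covRows P α S i j = crossMoment μ i.2 i.1 j.2 j.1 := by
  simp only [covRows, Matrix.of_apply, vecRows_apply, crossMoment]
  exact integral_comp_eq hS (f := fun x : SCM K V => x i.2 i.1 * x j.2 j.1)
    (Continuous.aestronglyMeasurable (by fun_prop))

lemma covRows_bilinear (h : IsCenteredLaw μ) (hS : HasLaw S μ P) (t s : Fin V × α → ℝ) :
    t ⬝ᵥ covRows P α S *ᵥ s =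
      ∫ x, pairing (extendRows α t) x * pairing (extendRows α s) x ∂μ := by
  have e : ∀ x : SCM K V, pairing (extendRows α t) x * pairing (extendRows α s) x =
      ∑ i : Fin V × α, ∑ j : Fin V × α, t i * s j * (x i.2 i.1 * x j.2 j.1) := by
    intro x
    rw [pairing_extendRows, pairing_extendRows, Finset.sum_mul_sum]
    refine Finset.sum_congr rfl fun i _ => Finset.sum_congr rfl fun j _ => ?_
    rw [vecRows_apply, vecRows_apply]
    ring
  have I := fun i j : Fin V × α => (h.integrable_mul i.2 i.1 j.2 j.1).const_mul (t i * s j)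
  simp only [e]
  rw [integral_finsetSum _ fun i _ => integrable_finsetSum _ fun j _ => I i j]
  simp only [dotProduct, mulVec, Finset.mul_sum]
  refine Finset.sum_congr rfl fun i _ => ?_
  rw [integral_finsetSum _ fun j _ => I i j]
  refine Finset.sum_congr rfl fun j _ => ?_
  rw [integral_const_mul, covRows_apply hS, crossMoment]
  ring

lemma covRows_quadratic (h : IsCenteredLaw μ) (hS : HasLaw S μ P) (t : Fin V × α → ℝ) :
    t ⬝ᵥ covRows P α S *ᵥ t = ∫ x, pairing (extendRows α t) x ^ 2 ∂μ := by
  simp only [covRows_bilinear h hS, sq]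

lemma covRows_posDef (h : IsCenteredLaw μ) (hS : HasLaw S μ P) : (covRows P α S).PosDef := by
  refine Matrix.PosDef.of_dotProduct_mulVec_pos ?_ fun t ht => ?_
  · ext i j
    simp only [conjTranspose_apply, star_trivial, covRows, of_apply, mul_comm]
  · rw [star_trivial, covRows_quadratic h hS]
    exact h.integral_pairing_sq_pos (mt extendRows_eq_zero_iff.1 ht)

lemma integral_exp_vecRows (hS : HasLaw S μ P) (t : Fin V × α → ℝ) :
    ∫ ω, Complex.exp ((∑ i, t i * vecRows α (S ω) i : ℝ) * Complex.I) ∂P =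
      cf μ (extendRows α t) := by
  rw [cf, ← integral_comp_eq hS (continuous_wave _).aestronglyMeasurable]
  simp only [wave, pairing_extendRows]

lemma aemeasurable_vecRows (hS : HasLaw S μ P) :
    AEMeasurable (fun ω => vecRows α (S ω)) P :=
  continuous_vecRows.measurable.comp_aemeasurable hS.aemeasurable

lemma charFun_vecRows (hS : HasLaw S μ P) (t : EuclideanSpace ℝ (Fin V × α)) :
    charFun (P.map fun ω => WithLp.toLp 2 (vecRows α (S ω))) t = cf μ (extendRows α t) := by
  rw [charFun_apply, integral_map, ← integral_exp_vecRows hS]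
  · simp [PiLp.inner_apply]
  · exact (WithLp.measurable_toLp 2 _).comp_aemeasurable (aemeasurable_vecRows hS)
  · exact Continuous.aestronglyMeasurable (by fun_prop)

lemma charFunDual_vecRows {β : Finset (Fin K)} (hS : HasLaw S μ P)
    (L : StrongDual ℝ (Fin V × β → ℝ)) :
    charFunDual (P.map fun ω => vecRows β (S ω)) L =
      cf μ (extendRows β fun i => L fun j => if i = j then 1 else 0) := by
  rw [charFunDual_apply, integral_map (aemeasurable_vecRows hS)
    (Continuous.aestronglyMeasurable (by fun_prop)), ← integral_exp_vecRows hS]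
  refine integral_congr_ae (Eventually.of_forall fun ω => ?_)
  have := L.toLinearMap.pi_apply_eq_sum_univ (vecRows β (S ω))
  simp only [ContinuousLinearMap.coe_coe, smul_eq_mul] at this
  simp only [this, mul_comm]

/-- Factorization of the joint characteristic function is independence, and its normal factor
identifies the marginal. Nonsingularity is not part of the hypothesis `SplitsGaussian`: it follows
from the existence of a density. -/
lemma SplitsGaussian.hasGaussianComponent [IsProbabilityMeasure P] (h : IsCenteredLaw μ)
    (hS : HasLaw S μ P) (hG : SplitsGaussian μ α) : HasGaussianComponent P α S := by
  have hpd := covRows_posDef (α := α) h hS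
  refine ⟨?_, ⟨(WithLp.measurable_toLp 2 _).comp_aemeasurable (aemeasurable_vecRows hS), ?_⟩,
    hpd.isUnit.map (Matrix.detMonoidHom)⟩
  · rw [indepFun_iff_charFunDual_prod (aemeasurable_vecRows hS) (aemeasurable_vecRows hS)]
    intro L
    rw [charFunDual_vecRows hS, charFunDual_vecRows hS, charFunDual_apply, integral_map
      ((aemeasurable_vecRows hS).prodMk (aemeasurable_vecRows hS))
      (Continuous.aestronglyMeasurable (by fun_prop))]
    set a := extendRows α fun i => (L.comp (.inl ℝ _ _)) fun j => if i = j then 1 else 0 with ha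
    set b := extendRows αᶜ fun i => (L.comp (.inr ℝ _ _)) fun j => if i = j then 1 else 0 with hb
    have e : ∀ ω, Complex.exp (L (vecRows α (S ω), vecRows αᶜ (S ω)) * Complex.I) =
        wave (a + b) (S ω) := by
      intro ω
      have h1 := (L.comp (.inl ℝ _ _)).toLinearMap.pi_apply_eq_sum_univ (vecRows α (S ω))
      have h2 := (L.comp (.inr ℝ _ _)).toLinearMap.pi_apply_eq_sum_univ (vecRows αᶜ (S ω))
      rw [wave, pairing_add_left, ha, hb, pairing_extendRows, pairing_extendRows]
      simp only [ContinuousLinearMap.coe_coe, smul_eq_mul] at h1 h2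
      simp only [mul_comm (L.comp _ _), ← h1, ← h2]
      congr 3
      simp [← map_add]
    simp only [e]
    rw [integral_comp_eq hS (continuous_wave _).aestronglyMeasurable, ← cf]
    have hab : onRows α (a + b) = a ∧ onRows αᶜ (a + b) = b := by
      constructor <;> ext k v <;> by_cases hk : k ∈ α <;> simp [onRows, ha, hb, extendRows, hk]
    rw [hG (a + b), hab.1, hab.2, hG a, ha, onRows_extendRows, onRows_compl_extendRows,
      h.cf_zero, mul_one]
  · have : IsProbabilityMeasure (P.map fun ω => WithLp.toLp 2 (vecRows α (S ω))) :=
      Measure.isProbabilityMeasure_map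
        ((WithLp.measurable_toLp 2 _).comp_aemeasurable (aemeasurable_vecRows hS))
    refine Measure.ext_of_charFun (funext fun t => ?_)
    rw [charFun_vecRows hS, charFun_multivariateGaussian hpd.posSemidef, hG, onRows_extendRows,
      onRows_compl_extendRows, h.cf_zero, mul_one, covRows_quadratic h hS]
    congr 1
    simp
    ring

lemma HasGaussianComponent.splitsGaussian (h : IsCenteredLaw μ)
    (hS : HasLaw S μ P) (hG : HasGaussianComponent P α S) : SplitsGaussian μ α := by
  have hpd := covRows_posDef (α := α) h hS
  intro u
  have h1 : cf μ u = (∫ ω, Complex.exp ((∑ i, vecRows α u i * vecRows α (S ω) i : ℝ) *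
      Complex.I) ∂P) * ∫ ω, Complex.exp ((∑ i, vecRows αᶜ u i * vecRows αᶜ (S ω) i : ℝ) *
      Complex.I) ∂P := by
    rw [← hG.indep.integral_fun_comp_mul_comp
      (f := fun y => Complex.exp ((∑ i, vecRows α u i * y i : ℝ) * Complex.I))
      (g := fun y => Complex.exp ((∑ i, vecRows αᶜ u i * y i : ℝ) * Complex.I))
      (aemeasurable_vecRows hS) (aemeasurable_vecRows hS)
      (Continuous.aestronglyMeasurable (by fun_prop))
      (Continuous.aestronglyMeasurable (by fun_prop)), cf,
      ← integral_comp_eq hS (continuous_wave _).aestronglyMeasurable]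
    refine integral_congr_ae (Eventually.of_forall fun ω => ?_)
    simp only [← Complex.exp_add, ← add_mul, ← Complex.ofReal_add, ← pairing_extendRows,
      ← pairing_add_left, extendRows_vecRows, onRows_add_compl]
    rfl
  have h2 := charFun_vecRows hS (WithLp.toLp 2 (vecRows α u))
  rw [hG.hasLaw.map_eq, charFun_multivariateGaussian hpd.posSemidef, covRows_quadratic h hS] at h2
  simp only [extendRows_vecRows] at h2
  rw [h1, integral_exp_vecRows hS, integral_exp_vecRows hS, extendRows_vecRows,
    extendRows_vecRows, ← h2]
  congr 2
  simp
  ring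

/-- Stein's identity for the normal factor. -/
lemma SplitsGaussian.integral_pairing_mul_wave (h : IsCenteredLaw μ) (hG : SplitsGaussian μ α)
    {w : SCM K V} (hw : onRows α w = w) (u : SCM K V) :
    ∫ x, (pairing w x : ℂ) * wave u x ∂μ =
      Complex.I * (∫ x, pairing w x * pairing (onRows α u) x ∂μ : ℝ) * cf μ u := by
  have hw' : onRows αᶜ w = 0 := by
    ext k v
    rw [← hw]
    by_cases hk : k ∈ α <;> simp [onRows, hk]
  have hd := h.hasDerivAt_cf u w 0
  rw [← h.integral_pairing_mul_wave, zero_smul, add_zero] at hd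
  set a := ∫ x, pairing (onRows α u) x ^ 2 ∂μ
  set b := ∫ x, pairing w x * pairing (onRows α u) x ∂μ
  set c := ∫ x, pairing w x ^ 2 ∂μ
  have hq : ∀ s : ℝ, ∫ x, pairing (onRows α (u + s • w)) x ^ 2 ∂μ = a + 2 * s * b + s ^ 2 * c := by
    intro s
    have e1 : onRows α (u + s • w) = onRows α u + s • w := by
      conv_rhs => rw [← hw]
      ext k v
      by_cases hk : k ∈ α <;> simp [onRows, hk]
    have e2 : ∀ x, pairing (onRows α u + s • w) x ^ 2 = pairing (onRows α u) x ^ 2 +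
        2 * s * (pairing w x * pairing (onRows α u) x) + s ^ 2 * pairing w x ^ 2 := by
      intro x
      rw [pairing_add_left, pairing_smul_left]
      ring
    have i1 := (h.memLp_pairing (onRows α u)).integrable_sq
    have i2 : Integrable (fun x => 2 * s * (pairing w x * pairing (onRows α u) x)) μ :=
      ((h.memLp_pairing w).integrable_mul (h.memLp_pairing (onRows α u))).const_mul (2 * s)
    have i3 := (h.memLp_pairing w).integrable_sq.const_mul (s ^ 2)
    simp only [e1, e2]
    rw [integral_add (by exact i1.add i2) i3, integral_add i1 i2, integral_const_mul, integral_const_mul]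
  -- Moving along `w` changes only the explicit normal factor. Stein's identity comes from comparing
  -- two derivatives at `s = 0`, one of the integral and one of this formula.
  have hf : ∀ s : ℝ, cf μ (u + s • w) =
      Complex.exp (-((a + 2 * s * b + s ^ 2 * c : ℝ) : ℂ) / 2) * cf μ (onRows αᶜ u) := by
    intro s
    rw [hG, hq]
    congr 2
    ext k v
    have := congrFun (congrFun hw' k) v
    by_cases hk : k ∈ α <;> simp_all [onRows]
  have hd2 : HasDerivAt (fun s : ℝ => Complex.exp (-((a + 2 * s * b + s ^ 2 * c : ℝ) : ℂ) / 2) *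
      cf μ (onRows αᶜ u)) (-(b : ℂ) * cf μ u) 0 := by
    have h1 : HasDerivAt (fun s : ℝ => a + 2 * s * b + s ^ 2 * c) (2 * b) 0 := by
      have := (((hasDerivAt_id (0 : ℝ)).const_mul 2).mul_const b).const_add a |>.add
        ((hasDerivAt_pow 2 (0 : ℝ)).mul_const c)
      exact this.congr_deriv (by simp)
    refine (((h1.ofReal_comp.neg.div_const 2).cexp).mul_const _).congr_deriv ?_
    have := hf 0
    rw [zero_smul, add_zero] at this
    rw [this]
    simp only [Pi.neg_apply]
    push_cast
    ring
  simp only [hf] at hd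
  have := hd.unique hd2
  linear_combination (-Complex.I) * this +
    (∫ x, (pairing w x : ℂ) * wave u x ∂μ) * Complex.I_mul_I

end gaussianComponent

/-! ### Uniqueness of Fourier transforms -/

section uniqueness

variable {K V : ℕ}

lemma ext_of_cf {μ ν : Measure (SCM K V)} [IsFiniteMeasure μ] [IsFiniteMeasure ν]
    (h : ∀ u, cf μ u = cf ν u) : μ = ν := by
  refine Measure.ext_of_charFunDual (funext fun L => ?_)
  have e : ∀ x : SCM K V, L x = pairing (fun k v => L (entryDir k v)) x := by
    intro x
    have hx : x = ∑ k, ∑ v, x k v • entryDir k v := by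
      ext k v
      simp [entryDir, Finset.sum_apply, Pi.single_apply, ite_apply]
    conv_lhs => rw [hx]
    simp only [map_sum, map_smul, smul_eq_mul, pairing, mul_comm]
  have := h fun k v => L (entryDir k v)
  rw [charFunDual_apply, charFunDual_apply]
  simpa only [cf, wave, ← e] using this

/-- The positive and negative parts of `f` are densities of two finite measures with the same
characteristic function, so they agree almost everywhere; one of them is zero at each point. -/
lemma ae_eq_zero_of_integral_mul_wave {μ : Measure (SCM K V)} [IsFiniteMeasure μ]
    {f : SCM K V → ℝ} (hf : Integrable f μ)
    (h : ∀ u, ∫ x, (f x : ℂ) * wave u x ∂μ = 0) : f =ᵐ[μ] 0 := by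
  have hfin : ∀ g : SCM K V → ℝ, Integrable g μ → ∫⁻ x, ENNReal.ofReal (g x) ∂μ ≠ ⊤ :=
    fun g hg => ((lintegral_mono fun x => Real.ofReal_le_enorm (g x)).trans_lt hg.2).ne
  have hm1 : AEMeasurable (fun x => ENNReal.ofReal (f x)) μ := hf.aemeasurable.ennreal_ofReal
  have hm2 : AEMeasurable (fun x => ENNReal.ofReal (-f x)) μ :=
    hf.neg.aemeasurable.ennreal_ofReal
  have f1 : IsFiniteMeasure (μ.withDensity fun x => ENNReal.ofReal (f x)) :=
    isFiniteMeasure_withDensity (hfin f hf)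
  have f2 : IsFiniteMeasure (μ.withDensity fun x => ENNReal.ofReal (-f x)) :=
    isFiniteMeasure_withDensity (hfin _ hf.neg)
  have key : (μ.withDensity fun x => ENNReal.ofReal (f x)) =
      μ.withDensity fun x => ENNReal.ofReal (-f x) := by
    refine ext_of_cf fun u => ?_
    rw [cf, cf, integral_withDensity_eq_integral_toReal_smul₀ hm1
      (Eventually.of_forall fun _ => ENNReal.ofReal_lt_top),
      integral_withDensity_eq_integral_toReal_smul₀ hm2
      (Eventually.of_forall fun _ => ENNReal.ofReal_lt_top), ← sub_eq_zero, ← integral_sub]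
    · rw [← h u]
      refine integral_congr_ae (Eventually.of_forall fun x => ?_)
      simp only [ENNReal.toReal_ofReal', Complex.real_smul]
      rcases le_total (f x) 0 with hx | hx
      · rw [max_eq_right hx, max_eq_left (by linarith)]
        push_cast
        ring
      · rw [max_eq_left hx, max_eq_right (by linarith)]
        push_cast
        ring
    · refine Integrable.mono hf (hm1.ennreal_toReal.aestronglyMeasurable.smul
        (continuous_wave u).aestronglyMeasurable) (Eventually.of_forall fun x => ?_)
      rw [norm_smul, norm_wave, mul_one, ENNReal.toReal_ofReal']
      simp only [Real.norm_eq_abs]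
      rw [abs_of_nonneg (le_max_right _ _)]
      exact max_le (le_abs_self _) (abs_nonneg _)
    · refine Integrable.mono hf (hm2.ennreal_toReal.aestronglyMeasurable.smul
        (continuous_wave u).aestronglyMeasurable) (Eventually.of_forall fun x => ?_)
      rw [norm_smul, norm_wave, mul_one, ENNReal.toReal_ofReal']
      simp only [Real.norm_eq_abs]
      rw [abs_of_nonneg (le_max_right _ _)]
      exact max_le (neg_le_abs _) (abs_nonneg _)
  rw [withDensity_eq_iff hm1 hm2 (hfin f hf)] at key
  filter_upwards [key] with x hx
  rcases le_total (f x) 0 with h0 | h0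
  · rw [ENNReal.ofReal_of_nonpos h0, eq_comm, ENNReal.ofReal_eq_zero] at hx
    exact le_antisymm h0 (neg_nonpos.1 hx)
  · rw [ENNReal.ofReal_of_nonpos (by linarith : -f x ≤ 0), ENNReal.ofReal_eq_zero] at hx
    exact le_antisymm hx h0

end uniqueness

/-! ### Integration by parts for the score -/

namespace IsSourceDensity

variable {K V : ℕ} {p : SCM K V → ℝ}

lemma integral_sourceLaw (hp : IsSourceDensity p) (f : SCM K V → ℝ) :
    ∫ x, f x ∂(sourceLaw p) = ∫ x, p x * f x := by
  rw [sourceLaw, integral_withDensity_eq_integral_toReal_smul hp.measurable.ennreal_ofReal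
    (Eventually.of_forall fun _ => ENNReal.ofReal_lt_top)]
  simp only [ENNReal.toReal_ofReal (hp.nonneg _), smul_eq_mul]

/-- Integration by parts against smooth functions that need not have compact support. -/
lemma integral_score_mul (hp : IsSourceDensity p) (k : Fin K) (v : Fin V) {ξ : SCM K V → ℝ}
    (hξ : ContDiff ℝ (⊤ : ℕ∞) ξ) (hξ2 : MemLp ξ 2 (sourceLaw p))
    (hdξ : Integrable (fun x => fderiv ℝ ξ x (entryDir k v)) (sourceLaw p)) :
    ∫ x, score p x k v * ξ x ∂(sourceLaw p) =
      ∫ x, fderiv ℝ ξ x (entryDir k v) ∂(sourceLaw p) := by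
  have := hp.isProbabilityMeasure
  -- Cutoff at scale `n + 1`: the functions `χ (c n • x)` tend to one pointwise, and their
  -- derivatives are `O(c n)`, so the weak formula for `ξ * χn n` passes to the limit by dominated
  -- convergence.
  let χ : ContDiffBump (0 : SCM K V) := ⟨1, 2, one_pos, one_lt_two⟩
  have hχ : ContDiff ℝ (⊤ : ℕ∞) χ := χ.contDiff
  have hχd : Continuous (fderiv ℝ χ) := hχ.continuous_fderiv (by simp)
  obtain ⟨C, hC⟩ := χ.hasCompactSupport.fderiv (𝕜 := ℝ) |>.exists_bound_of_continuous hχd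
  have hC0 : 0 ≤ C := (norm_nonneg _).trans (hC 0)
  let c : ℕ → ℝ := fun n => 1 / ((n : ℝ) + 1)
  have hc0 : ∀ n, 0 < c n := fun n => Nat.one_div_pos_of_nat
  have hc1 : ∀ n, c n ≤ 1 := fun n => by
    have : (1 : ℝ) ≤ (n : ℝ) + 1 := by simp
    exact (div_le_one (by linarith)).2 this
  have hclim : Tendsto c atTop (𝓝 0) := tendsto_one_div_add_atTop_nhds_zero_nat
  let χn : ℕ → SCM K V → ℝ := fun n x => χ (c n • x)
  have hχn : ∀ n, ContDiff ℝ (⊤ : ℕ∞) (χn n) := fun n => hχ.comp (contDiff_const_smul (c n))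
  have hχnd : ∀ n x, fderiv ℝ (χn n) x = c n • fderiv ℝ χ (c n • x) := by
    intro n x
    exact fderiv_comp_smul (c n)
  have hχn_supp : ∀ n, HasCompactSupport (χn n) := fun n =>
    χ.hasCompactSupport.comp_homeomorph (Homeomorph.smulOfNeZero (c n) (hc0 n).ne')
  have hχn1 : ∀ n x, |χn n x| ≤ 1 := fun n x => by
    rw [abs_of_nonneg χ.nonneg]
    exact χ.le_one
  have hχnlim : ∀ x, Tendsto (fun n => χn n x) atTop (𝓝 1) := by
    intro x
    have h1 : Tendsto (fun n => c n • x) atTop (𝓝 0) := by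
      simpa using hclim.smul_const x
    have h2 := (hχ.continuous.tendsto 0).comp h1
    rwa [χ.one_of_mem_closedBall (Metric.mem_closedBall_self zero_le_one)] at h2
  set e : SCM K V := entryDir k v with he
  have hdbd : ∀ n x, |fderiv ℝ (χn n) x e| ≤ c n * (C * ‖e‖) := by
    intro n x
    rw [hχnd, _root_.smul_apply, smul_eq_mul, abs_mul, abs_of_pos (hc0 n)]
    exact mul_le_mul_of_nonneg_left ((fderiv ℝ χ (c n • x)).le_of_opNorm_le (hC _) e) (hc0 n).le
  have hparts : ∀ n, ∫ x, (fderiv ℝ ξ x e * χn n x + ξ x * fderiv ℝ (χn n) x e) ∂(sourceLaw p) =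
      ∫ x, score p x k v * ξ x * χn n x ∂(sourceLaw p) := by
    intro n
    have h1 := hp.integral_by_parts k v (fun x => ξ x * χn n x) (hξ.mul (hχn n))
      ((hχn_supp n).mul_left)
    rw [hp.integral_sourceLaw, hp.integral_sourceLaw]
    refine Eq.trans ?_ (h1.trans ?_)
    · refine integral_congr_ae (Eventually.of_forall fun x => ?_)
      simp only
      rw [fderiv_fun_mul (hξ.differentiable (by simp) x) ((hχn n).differentiable (by simp) x)]
      simp only [_root_.add_apply, _root_.smul_apply, smul_eq_mul, he]
      ring
    · refine integral_congr_ae (Eventually.of_forall fun x => ?_)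
      ring_nf
  have hscξ : Integrable (fun x => score p x k v * ξ x) (sourceLaw p) :=
    (hp.memLp_score k v).integrable_mul hξ2
  have hξ1 : Integrable ξ (sourceLaw p) := hξ2.integrable (by norm_num)
  have hdm : ∀ n, Continuous fun x => fderiv ℝ (χn n) x e := fun n =>
    ((hχn n).continuous_fderiv (by simp)).clm_apply continuous_const
  have hL : Tendsto (fun n => ∫ x, (fderiv ℝ ξ x e * χn n x + ξ x * fderiv ℝ (χn n) x e)
      ∂(sourceLaw p)) atTop (𝓝 (∫ x, fderiv ℝ ξ x e ∂(sourceLaw p))) := by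
    refine tendsto_integral_of_dominated_convergence
      (fun x => |fderiv ℝ ξ x e| + |ξ x| * (C * ‖e‖)) (fun n => ?_)
      (hdξ.abs.add (hξ1.abs.mul_const _)) (fun n => Eventually.of_forall fun x => ?_)
      (Eventually.of_forall fun x => ?_)
    · exact (hdξ.aestronglyMeasurable.mul (hχn n).continuous.aestronglyMeasurable).add
        (hξ1.aestronglyMeasurable.mul (hdm n).aestronglyMeasurable)
    · refine (norm_add_le _ _).trans ?_
      simp only [norm_mul, Real.norm_eq_abs]
      gcongr
      · exact mul_le_of_le_one_right (abs_nonneg _) (hχn1 n x)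
      · exact (hdbd n x).trans (mul_le_of_le_one_left (by positivity) (hc1 n))
    · have h1 : Tendsto (fun n => fderiv ℝ (χn n) x e) atTop (𝓝 0) := by
        refine squeeze_zero_norm (fun n => hdbd n x) ?_
        simpa using hclim.mul_const (C * ‖e‖)
      simpa using ((hχnlim x).const_mul (fderiv ℝ ξ x e)).add (h1.const_mul (ξ x))
  have hR : Tendsto (fun n => ∫ x, score p x k v * ξ x * χn n x ∂(sourceLaw p)) atTop
      (𝓝 (∫ x, score p x k v * ξ x ∂(sourceLaw p))) := by
    refine tendsto_integral_of_dominated_convergence (fun x => |score p x k v * ξ x|)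
      (fun n => hscξ.aestronglyMeasurable.mul (hχn n).continuous.aestronglyMeasurable)
      hscξ.abs (fun n => Eventually.of_forall fun x => ?_) (Eventually.of_forall fun x => ?_)
    · rw [norm_mul, Real.norm_eq_abs, Real.norm_eq_abs]
      exact mul_le_of_le_one_right (abs_nonneg _) (hχn1 n x)
    · simpa using (hχnlim x).const_mul (score p x k v * ξ x)
  exact tendsto_nhds_unique (hR.congr fun n => (hparts n).symm) hL

lemma integral_score_mul_entry (hp : IsSourceDensity p) (k : Fin K) (v : Fin V) (l : Fin K)
    (w : Fin V) : ∫ x, score p x k v * x l w ∂(sourceLaw p) =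
      if l = k ∧ w = v then 1 else 0 := by
  have := hp.isProbabilityMeasure
  have hd : ∀ x : SCM K V, fderiv ℝ (fun x : SCM K V => x l w) x (entryDir k v) =
      if l = k ∧ w = v then 1 else 0 := by
    intro x
    let f : SCM K V →L[ℝ] ℝ := (ContinuousLinearMap.proj (R := ℝ) (φ := fun _ : Fin V => ℝ) w).comp
      (ContinuousLinearMap.proj (R := ℝ) (φ := fun _ : Fin K => Fin V → ℝ) l)
    change fderiv ℝ f x _ = _
    rw [f.fderiv]
    change entryDir k v l w = _
    simp [entryDir, Pi.single_apply, ite_apply, ite_and]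
  rw [hp.integral_score_mul k v (ξ := fun x => x l w) (by fun_prop) (hp.memLp_entry l w)]
  · simp [hd]
  · simp only [hd]
    exact integrable_const _

/-- The real and imaginary parts are integrated by parts separately, since test functions are
real-valued; the derivatives of cosine and sine recombine to `I * u k v` times the character. -/
lemma integral_score_mul_wave (hp : IsSourceDensity p) (k : Fin K) (v : Fin V) (u : SCM K V) :
    ∫ x, (score p x k v : ℂ) * wave u x ∂(sourceLaw p) =
      Complex.I * u k v * cf (sourceLaw p) u := by
  have := hp.isProbabilityMeasure
  have hpair : ContDiff ℝ (⊤ : ℕ∞) (pairing u) := by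
    unfold pairing
    fun_prop
  have hdp : ∀ x, HasFDerivAt (pairing u) (IsCenteredLaw.pairingCLM u) x := fun x =>
    (IsCenteredLaw.pairingCLM u).hasFDerivAt.congr_of_eventuallyEq
      (Eventually.of_forall fun y => pairing_comm u y)
  have hde : IsCenteredLaw.pairingCLM u (entryDir k v) = u k v := by
    rw [IsCenteredLaw.pairingCLM_apply, pairing_entryDir]
  have hcosc : Continuous fun x => Real.cos (pairing u x) :=
    Real.continuous_cos.comp (continuous_pairing u)
  have hsinc : Continuous fun x => Real.sin (pairing u x) :=
    Real.continuous_sin.comp (continuous_pairing u)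
  have hcosL : MemLp (fun x => Real.cos (pairing u x)) 2 (sourceLaw p) :=
    MemLp.of_bound hcosc.aestronglyMeasurable 1
      (Eventually.of_forall fun x => Real.abs_cos_le_one _)
  have hsinL : MemLp (fun x => Real.sin (pairing u x)) 2 (sourceLaw p) :=
    MemLp.of_bound hsinc.aestronglyMeasurable 1
      (Eventually.of_forall fun x => Real.abs_sin_le_one _)
  have hdcos : ∀ x, fderiv ℝ (fun x => Real.cos (pairing u x)) x (entryDir k v) =
      -u k v * Real.sin (pairing u x) := by
    intro x
    rw [(hdp x).cos.fderiv]
    simp [hde]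
    ring
  have hdsin : ∀ x, fderiv ℝ (fun x => Real.sin (pairing u x)) x (entryDir k v) =
      u k v * Real.cos (pairing u x) := by
    intro x
    rw [(hdp x).sin.fderiv]
    simp [hde]
    ring
  have hcosI := hcosL.integrable (q := 2) (by norm_num)
  have hsinI := hsinL.integrable (q := 2) (by norm_num)
  have h1 := hp.integral_score_mul k v hpair.cos hcosL (by
    simp only [hdcos]
    exact hsinI.const_mul _)
  have h2 := hp.integral_score_mul k v hpair.sin hsinL (by
    simp only [hdsin]
    exact hcosI.const_mul _)
  simp only [hdcos, hdsin, integral_const_mul] at h1 h2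
  have hw : ∀ x, wave u x = (Real.cos (pairing u x) : ℂ) +
      (Real.sin (pairing u x) : ℂ) * Complex.I := by
    intro x
    rw [wave, Complex.exp_mul_I, Complex.ofReal_cos, Complex.ofReal_sin]
  have hcf : cf (sourceLaw p) u = (∫ x, Real.cos (pairing u x) ∂(sourceLaw p) : ℝ) +
      (∫ x, Real.sin (pairing u x) ∂(sourceLaw p) : ℝ) * Complex.I := by
    simp only [cf, hw]
    rw [integral_add hcosI.ofReal (hsinI.ofReal.mul_const _), integral_mul_const,
      integral_complex_ofReal, integral_complex_ofReal]
  have i1 := (hp.memLp_score k v).integrable_mul hcosL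
  have i2 := (hp.memLp_score k v).integrable_mul hsinL
  have hsplit : ∫ x, (score p x k v : ℂ) * wave u x ∂(sourceLaw p) =
      (∫ x, score p x k v * Real.cos (pairing u x) ∂(sourceLaw p) : ℝ) +
      (∫ x, score p x k v * Real.sin (pairing u x) ∂(sourceLaw p) : ℝ) * Complex.I := by
    rw [← integral_complex_ofReal, ← integral_complex_ofReal, ← integral_mul_const,
      ← integral_add i1.ofReal (i2.ofReal.mul_const _)]
    refine integral_congr_ae (Eventually.of_forall fun x => ?_)
    simp only [hw]
    push_cast
    ring
  rw [hsplit, h1, h2, hcf]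
  push_cast
  linear_combination (-(u k v : ℂ) * (∫ x, Real.sin (pairing u x) ∂(sourceLaw p) : ℝ)) *
    Complex.I_mul_I

/-- On a normal factor the score is linear. -/
lemma score_ae_eq (hp : IsSourceDensity p) {Ω : Type*} [MeasurableSpace Ω] {P : Measure Ω}
    {S : Ω → SCM K V} {α : Finset (Fin K)} (hS : HasLaw S (sourceLaw p) P)
    (hG : SplitsGaussian (sourceLaw p) α) (i : Fin V × α) :
    ∀ᵐ x ∂(sourceLaw p), score p x i.2 i.1 = ((covRows P α S)⁻¹ *ᵥ vecRows α x) i := by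
  have := hp.isProbabilityMeasure
  have h := hp.isCenteredLaw
  set R := covRows P α S with hR
  have hdet : IsUnit R.det := (covRows_posDef h hS).isUnit.map Matrix.detMonoidHom
  set w := extendRows α (R⁻¹ i) with hw
  have hpair : ∀ x, (R⁻¹ *ᵥ vecRows α x) i = pairing w x := fun x => by
    rw [hw, pairing_extendRows]
    rfl
  have hcov : ∀ u : SCM K V, ∫ x, pairing w x * pairing (onRows α u) x ∂(sourceLaw p) =
      u i.2 i.1 := by
    intro u
    rw [← extendRows_vecRows, hw, ← covRows_bilinear h hS]
    change (R⁻¹ *ᵥ (R *ᵥ vecRows α u)) i = _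
    rw [mulVec_mulVec, nonsing_inv_mul _ hdet, one_mulVec, vecRows_apply]
  have i1 : Integrable (fun x => score p x i.2 i.1) (sourceLaw p) :=
    (hp.memLp_score i.2 i.1).integrable (by norm_num)
  have i2 : Integrable (pairing w) (sourceLaw p) := (h.memLp_pairing w).integrable (by norm_num)
  -- The score and the linear function `pairing w` have the same Fourier transform `I * u i.2 i.1 *
  -- cf u`: the first by parts, the second by Stein's identity, where `R⁻¹` cancels `R`.
  have key := ae_eq_zero_of_integral_mul_wave (i1.sub i2) (fun u => by
    simp only [Pi.sub_apply, Complex.ofReal_sub, sub_mul]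
    rw [integral_sub, hp.integral_score_mul_wave,
      hG.integral_pairing_mul_wave h (by rw [hw, onRows_extendRows]), hcov, sub_self]
    · exact (hp.memLp_score i.2 i.1).ofReal.integrable_mul (h.memLp_wave u)
    · exact (h.memLp_pairing w).ofReal.integrable_mul (h.memLp_wave u))
  filter_upwards [key] with x hx
  rw [hpair]
  exact sub_eq_zero.1 hx

end IsSourceDensity

/-! ### Assembling a matching pair -/

/-- If two sources have suitably related normal factors, then they have matching components. -/
lemma hasMatchingGaussianPair_of_splitsGaussian {N K V : ℕ} {Ω : Type*} [MeasurableSpace Ω]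
    {P : Measure Ω} [IsProbabilityMeasure P] {S : Fin N → Ω → SCM K V}
    {μ : Fin N → Measure (SCM K V)} (hμ : ∀ n, IsCenteredLaw (μ n))
    (hS : ∀ n, HasLaw (S n) (μ n) P) {m n : Fin N} (hmn : m ≠ n) {α : Finset (Fin K)}
    (hα : α.Nonempty) (hm : SplitsGaussian (μ m) α) (hn : SplitsGaussian (μ n) α) (d : Fin K → ℝ)
    (hd : ∀ k ∈ α, d k ≠ 0) (hcov : ∀ k ∈ α, ∀ l ∈ α, ∀ v w,
      crossMoment (μ m) k v l w = d k * d l * crossMoment (μ n) k v l w) :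
    HasMatchingGaussianPair P S := by
  refine ⟨α, hα, m, n, hmn, hm.hasGaussianComponent (hμ m) (hS m),
    hn.hasGaussianComponent (hμ n) (hS n), fun k => d k, fun k => hd k k.2, ?_⟩
  ext i j
  rw [← diagonal_one, diagonal_kronecker_diagonal, mul_diagonal, diagonal_mul,
    covRows_apply (hS m), covRows_apply (hS n), hcov _ i.2.2 _ j.2.2]
  ring

/-- Without samples the matrix space is a point. This case is separate because the sign arguments
elsewhere need a sample with positive variance. -/
lemma splitsGaussian_of_isEmpty {K V : ℕ} [IsEmpty (Fin V)] (μ : Measure (SCM K V))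
    (h : IsCenteredLaw μ) (α : Finset (Fin K)) : SplitsGaussian μ α := by
  have := h.isProb
  intro u
  have : ∀ u : SCM K V, u = 0 := fun u => by
    ext k v
    exact isEmptyElim v
  simp [this, h.cf_zero, pairing_zero_left]

/-! ### The Fisher block as a covariance matrix -/

lemma pairVector_inl {N K V : ℕ} {Ω : Type*} (p : Fin N → SCM K V → ℝ) (S : Fin N → Ω → SCM K V)
    (m n : Fin N) (ω : Ω) (k : Fin K) :
    pairVector p S m n ω (Sum.inl k) = ∑ v, score (p m) (S m ω) k v * S n ω k v := rfl

lemma pairVector_inr {N K V : ℕ} {Ω : Type*} (p : Fin N → SCM K V → ℝ) (S : Fin N → Ω → SCM K V)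
    (m n : Fin N) (ω : Ω) (k : Fin K) :
    pairVector p S m n ω (Sum.inr k) = ∑ v, S m ω k v * score (p n) (S n ω) k v := by
  change ∑ v, score (p n) (S n ω) k v * S m ω k v = _
  exact Finset.sum_congr rfl fun _ _ => mul_comm _ _

section fisher

variable {N K V : ℕ} {Ω : Type*} [MeasurableSpace Ω] {P : Measure Ω}
  {p : Fin N → SCM K V → ℝ} {S : Fin N → Ω → SCM K V}

namespace IsSourceModel

lemma integral_mul (hS : IsSourceModel P p S) {m n : Fin N} (hmn : m ≠ n) {f g : SCM K V → ℂ}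
    (hf : AEStronglyMeasurable f (sourceLaw (p m)))
    (hg : AEStronglyMeasurable g (sourceLaw (p n))) :
    ∫ ω, f (S m ω) * g (S n ω) ∂P =
      (∫ x, f x ∂(sourceLaw (p m))) * ∫ y, g y ∂(sourceLaw (p n)) := by
  rw [(hS.indep.indepFun hmn).integral_fun_comp_mul_comp (hS.hasLaw m).aemeasurable
    (hS.hasLaw n).aemeasurable (by rwa [(hS.hasLaw m).map_eq]) (by rwa [(hS.hasLaw n).map_eq]),
    integral_comp_eq (hS.hasLaw m) hf, integral_comp_eq (hS.hasLaw n) hg]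

lemma integrable_comp (hS : IsSourceModel P p S) {n : Fin N} {E : Type*} [NormedAddCommGroup E]
    {f : SCM K V → E}
    (hf : Integrable f (sourceLaw (p n))) : Integrable (fun ω => f (S n ω)) P := by
  rw [← (hS.hasLaw n).map_eq] at hf
  exact hf.comp_aemeasurable (hS.hasLaw n).aemeasurable

lemma aestronglyMeasurable_comp (hS : IsSourceModel P p S) {n : Fin N} {E : Type*}
    [NormedAddCommGroup E] {f : SCM K V → E} (hf : AEStronglyMeasurable f (sourceLaw (p n))) :
    AEStronglyMeasurable (fun ω => f (S n ω)) P := by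
  rw [← (hS.hasLaw n).map_eq] at hf
  exact hf.comp_aemeasurable (hS.hasLaw n).aemeasurable

lemma indepFun_comp (hS : IsSourceModel P p S) {m n : Fin N} (hmn : m ≠ n) {E : Type*}
    [NormedAddCommGroup E] [MeasurableSpace E] [BorelSpace E] {f g : SCM K V → E}
    (hf : AEStronglyMeasurable f (sourceLaw (p m)))
    (hg : AEStronglyMeasurable g (sourceLaw (p n))) :
    IndepFun (fun ω => f (S m ω)) (fun ω => g (S n ω)) P :=
  (hS.indep.indepFun hmn).comp₀ (hS.hasLaw m).aemeasurable (hS.hasLaw n).aemeasurable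
    (by rw [(hS.hasLaw m).map_eq]; exact hf.aemeasurable)
    (by rw [(hS.hasLaw n).map_eq]; exact hg.aemeasurable)

lemma integrable_mul (hS : IsSourceModel P p S) {m n : Fin N} (hmn : m ≠ n) {f g : SCM K V → ℂ}
    (hf : Integrable f (sourceLaw (p m))) (hg : Integrable g (sourceLaw (p n))) :
    Integrable (fun ω => f (S m ω) * g (S n ω)) P :=
  (hS.indepFun_comp hmn hf.aestronglyMeasurable hg.aestronglyMeasurable).integrable_mul
    (hS.integrable_comp hf) (hS.integrable_comp hg)

lemma memLp_mul (hS : IsSourceModel P p S) {m n : Fin N} (hmn : m ≠ n) {f g : SCM K V → ℝ}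
    (hf : MemLp f 2 (sourceLaw (p m))) (hg : MemLp g 2 (sourceLaw (p n))) :
    MemLp (fun ω => f (S m ω) * g (S n ω)) 2 P := by
  have hm : AEStronglyMeasurable (fun ω => f (S m ω) * g (S n ω)) P :=
    (hS.aestronglyMeasurable_comp hf.1).mul (hS.aestronglyMeasurable_comp hg.1)
  rw [memLp_two_iff_integrable_sq hm]
  simp only [mul_pow]
  exact (hS.indepFun_comp hmn (f := fun x => f x ^ 2) (g := fun x => g x ^ 2)
    (hf.integrable_sq.aestronglyMeasurable) (hg.integrable_sq.aestronglyMeasurable)).integrable_mul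
    (hS.integrable_comp hf.integrable_sq) (hS.integrable_comp hg.integrable_sq)

lemma memLp_pairVector (hS : IsSourceModel P p S) {m n : Fin N} (hmn : m ≠ n)
    (i : Fin K ⊕ Fin K) : MemLp (fun ω => pairVector p S m n ω i) 2 P := by
  cases i with
  | inl k =>
    simp only [pairVector_inl]
    exact memLp_finsetSum _ fun v _ =>
      hS.memLp_mul hmn ((hS.density m).memLp_score k v) ((hS.density n).memLp_entry k v)
  | inr k =>
    simp only [pairVector_inr]
    exact memLp_finsetSum _ fun v _ =>
      hS.memLp_mul hmn ((hS.density m).memLp_entry k v) ((hS.density n).memLp_score k v)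

/-- Testing a linear combination of the entries of `pairVector` against a product. -/
lemma integral_pairVector_mul (hS : IsSourceModel P p S) {m n : Fin N} (hmn : m ≠ n)
    (z : Fin K ⊕ Fin K → ℝ) {f g : SCM K V → ℂ} (hf : MemLp f 2 (sourceLaw (p m)))
    (hg : MemLp g 2 (sourceLaw (p n))) :
    ∫ ω, ((∑ i, z i * pairVector p S m n ω i : ℝ) : ℂ) * (f (S m ω) * g (S n ω)) ∂P =
      ∑ k, ∑ v, ((z (Sum.inl k) : ℂ) * ((∫ x, score (p m) x k v * f x ∂(sourceLaw (p m))) *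
        ∫ y, y k v * g y ∂(sourceLaw (p n))) +
        (z (Sum.inr k) : ℂ) * ((∫ x, x k v * f x ∂(sourceLaw (p m))) *
        ∫ y, score (p n) y k v * g y ∂(sourceLaw (p n)))) := by
  have sf : ∀ k v, Integrable (fun x => (score (p m) x k v : ℂ) * f x) (sourceLaw (p m)) :=
    fun k v => ((hS.density m).memLp_score k v).ofReal.integrable_mul hf
  have sg : ∀ k v, Integrable (fun x => (score (p n) x k v : ℂ) * g x) (sourceLaw (p n)) :=
    fun k v => ((hS.density n).memLp_score k v).ofReal.integrable_mul hg
  have ef : ∀ k v, Integrable (fun x : SCM K V => (x k v : ℂ) * f x) (sourceLaw (p m)) :=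
    fun k v => ((hS.density m).memLp_entry k v).ofReal.integrable_mul hf
  have eg : ∀ k v, Integrable (fun x : SCM K V => (x k v : ℂ) * g x) (sourceLaw (p n)) :=
    fun k v => ((hS.density n).memLp_entry k v).ofReal.integrable_mul hg
  have e : ∀ ω, ((∑ i, z i * pairVector p S m n ω i : ℝ) : ℂ) * (f (S m ω) * g (S n ω)) =
      ∑ k, ∑ v, ((z (Sum.inl k) : ℂ) * ((score (p m) (S m ω) k v * f (S m ω)) *
        (S n ω k v * g (S n ω))) +
        (z (Sum.inr k) : ℂ) * ((S m ω k v * f (S m ω)) *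
        (score (p n) (S n ω) k v * g (S n ω)))) := by
    intro ω
    rw [Fintype.sum_sum_type]
    simp only [pairVector_inl, pairVector_inr]
    push_cast
    simp only [Finset.mul_sum, Finset.sum_mul, add_mul, ← Finset.sum_add_distrib]
    refine Finset.sum_congr rfl fun k _ => Finset.sum_congr rfl fun v _ => by ring
  simp only [e]
  have I : ∀ k v, Integrable (fun ω =>
      ((z (Sum.inl k) : ℂ) * (((score (p m) (S m ω) k v : ℝ) * f (S m ω)) *
        ((S n ω k v : ℝ) * g (S n ω))) +
        (z (Sum.inr k) : ℂ) * (((S m ω k v : ℝ) * f (S m ω)) *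
        ((score (p n) (S n ω) k v : ℝ) * g (S n ω))))) P := fun k v => ((hS.integrable_mul hmn (sf k v) (eg k v)).const_mul
    (z (Sum.inl k) : ℂ)).add ((hS.integrable_mul hmn (ef k v) (sg k v)).const_mul
    (z (Sum.inr k) : ℂ))
  rw [integral_finsetSum _ fun k _ => integrable_finsetSum _ fun v _ => I k v]
  refine Finset.sum_congr rfl fun k _ => ?_
  rw [integral_finsetSum _ fun v _ => I k v]
  refine Finset.sum_congr rfl fun v _ => ?_
  rw [integral_add ((hS.integrable_mul hmn (sf k v) (eg k v)).const_mul _)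
    ((hS.integrable_mul hmn (ef k v) (sg k v)).const_mul _), integral_const_mul,
    integral_const_mul, hS.integral_mul hmn (sf k v).1 (eg k v).1,
    hS.integral_mul hmn (ef k v).1 (sg k v).1]

lemma integral_sum_pairVector [IsProbabilityMeasure P] (hS : IsSourceModel P p S) {m n : Fin N}
    (hmn : m ≠ n) (z : Fin K ⊕ Fin K → ℝ) : ∫ ω, ∑ i, z i * pairVector p S m n ω i ∂P = 0 := by
  have := (hS.density m).isProbabilityMeasure
  have := (hS.density n).isProbabilityMeasure
  have h := hS.integral_pairVector_mul hmn z (f := fun _ => 1) (g := fun _ => 1) (memLp_const 1)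
    (memLp_const 1)
  simp only [mul_one, integral_complex_ofReal, (hS.density m).mean_zero,
    (hS.density n).mean_zero] at h
  simpa using h

/-- A null vector of a covariance matrix is a combination of zero variance, hence almost surely
equal to its mean, which is zero because the two sources are independent and centered. -/
lemma not_isUnit_det_fisherBlock_iff [IsProbabilityMeasure P] (hS : IsSourceModel P p S)
    {m n : Fin N} (hmn : m ≠ n) : ¬ IsUnit (fisherBlock P p S m n).det ↔
      ∃ z : Fin K ⊕ Fin K → ℝ, z ≠ 0 ∧ ∀ᵐ ω ∂P, ∑ i, z i * pairVector p S m n ω i = 0 := by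
  have hL := fun i => hS.memLp_pairVector hmn i
  have hLz := fun (z : Fin K ⊕ Fin K → ℝ) i => (hL i).const_mul (z i)
  have hmul : ∀ z i, (fisherBlock P p S m n *ᵥ z) i =
      covariance (fun ω => pairVector p S m n ω i)
        (fun ω => ∑ j, z j * pairVector p S m n ω j) P := by
    intro z i
    rw [covariance_fun_sum_right (hLz z) (hL i)]
    simp only [mulVec, dotProduct, fisherBlock, of_apply, covariance_const_mul_right]
    exact Finset.sum_congr rfl fun j _ => mul_comm _ _
  rw [isUnit_iff_ne_zero, not_not, ← exists_mulVec_eq_zero_iff]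
  refine exists_congr fun z => and_congr_right fun _ => ⟨fun h => ?_, fun h => ?_⟩
  · have hLs : MemLp (fun ω => ∑ j, z j * pairVector p S m n ω j) 2 P :=
      memLp_finsetSum _ fun i _ => hLz z i
    have hvar : Var[fun ω => ∑ j, z j * pairVector p S m n ω j; P] = 0 := by
      rw [← covariance_self hLs.1.aemeasurable, covariance_fun_sum_left (hLz z) hLs]
      simp only [covariance_const_mul_left, ← hmul, h]
      simp
    have := ae_eq_integral_of_variance_eq_zero hLs hvar
    rw [hS.integral_sum_pairVector hmn] at this
    exact this
  · ext i
    rw [hmul, covariance, hS.integral_sum_pairVector hmn]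
    refine integral_eq_zero_of_ae ?_
    filter_upwards [h] with ω hω
    simp [hω]

end IsSourceModel
end fisher

/-! ### Linear relations between the entries of `pairVector` -/

namespace IsSourceModel

variable {N K V : ℕ} {Ω : Type*} [MeasurableSpace Ω] {P : Measure Ω}
  {p : Fin N → SCM K V → ℝ} {S : Fin N → Ω → SCM K V} {m n : Fin N} {z : Fin K ⊕ Fin K → ℝ}

lemma memLp_entry_ofReal {q : SCM K V → ℝ} (hq : IsSourceDensity q) (k : Fin K) (v : Fin V) :
    MemLp (fun x : SCM K V => (x k v : ℂ)) 2 (sourceLaw q) := (hq.memLp_entry k v).ofReal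

lemma integral_entry_mul_ofReal (μ : Measure (SCM K V)) (k : Fin K) (v : Fin V) (l : Fin K)
    (w : Fin V) : ∫ x : SCM K V, (x k v : ℂ) * (x l w : ℂ) ∂μ = crossMoment μ k v l w := by
  rw [crossMoment, ← integral_complex_ofReal]
  simp only [Complex.ofReal_mul]

lemma integral_score_mul_ofReal {q : SCM K V → ℝ} (hq : IsSourceDensity q) (k : Fin K)
    (v : Fin V) (l : Fin K) (w : Fin V) :
    ∫ x : SCM K V, (score q x k v : ℂ) * (x l w : ℂ) ∂(sourceLaw q) =
      if k = l ∧ v = w then 1 else 0 := by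
  have := hq.integral_score_mul_entry k v l w
  simp only [← Complex.ofReal_mul]
  rw [integral_complex_ofReal, this]
  simp only [eq_comm (a := l), eq_comm (a := w)]
  split_ifs <;> simp

/-- An almost sure linear relation between the entries of `pairVector` intertwines the
covariances. -/
lemma crossMoment_relation (hS : IsSourceModel P p S) (hmn : m ≠ n)
    (hz : ∀ᵐ ω ∂P, ∑ i, z i * pairVector p S m n ω i = 0) (k : Fin K) (v : Fin V) (l : Fin K)
    (w : Fin V) : z (Sum.inl k) * crossMoment (sourceLaw (p n)) k v l w +
      z (Sum.inr l) * crossMoment (sourceLaw (p m)) k v l w = 0 := by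
  have h := hS.integral_pairVector_mul hmn z (memLp_entry_ofReal (hS.density m) k v)
    (memLp_entry_ofReal (hS.density n) l w)
  rw [integral_eq_zero_of_ae (by filter_upwards [hz] with ω hω; simp [hω])] at h
  simp only [integral_entry_mul_ofReal, integral_score_mul_ofReal (hS.density _)] at h
  simp only [Finset.sum_add_distrib, ite_and, ite_mul, mul_ite, one_mul, mul_one, zero_mul,
    mul_zero, Finset.sum_ite_irrel, Finset.sum_ite_eq', Finset.sum_const_zero, Finset.mem_univ,
    if_true] at h
  rw [IsCenteredLaw.crossMoment_symm (μ := sourceLaw (p m))]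
  exact_mod_cast h.symm

/-- The relation is tested against the character of `S m` times the entry `(l, w)` of `S n`. In the
second half only the index `(l, w)` survives and leaves `z (inr l) * cfEntry`; in the first half the
score of `S m` produces covariances of `S n`, which `crossMoment_relation` converts into covariances
of `S m` with the common factor `z (inr l)`. -/
lemma cfEntry_relation_left (hS : IsSourceModel P p S) (hmn : m ≠ n)
    (hz : ∀ᵐ ω ∂P, ∑ i, z i * pairVector p S m n ω i = 0) (l : Fin K) (hl : z (Sum.inr l) ≠ 0)
    (w : Fin V) (u : SCM K V) : cfEntry (sourceLaw (p m)) l w u =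
      Complex.I * covRow (sourceLaw (p m)) l w u * cf (sourceLaw (p m)) u := by
  have h := hS.integral_pairVector_mul hmn z ((hS.density m).isCenteredLaw.memLp_wave u)
    (memLp_entry_ofReal (hS.density n) l w)
  rw [integral_eq_zero_of_ae (by filter_upwards [hz] with ω hω; simp [hω])] at h
  simp only [integral_entry_mul_ofReal, integral_score_mul_ofReal (hS.density _),
    (hS.density m).integral_score_mul_wave] at h
  simp only [Finset.sum_add_distrib, ite_and, mul_ite, mul_one, mul_zero, Finset.sum_ite_irrel, Finset.sum_ite_eq', Finset.sum_const_zero, Finset.mem_univ,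
    if_true] at h
  have e : ∑ k, ∑ v, (z (Sum.inl k) : ℂ) * (Complex.I * u k v * cf (sourceLaw (p m)) u *
      crossMoment (sourceLaw (p n)) k v l w) =
      -((z (Sum.inr l) : ℂ) * (Complex.I * covRow (sourceLaw (p m)) l w u *
        cf (sourceLaw (p m)) u)) := by
    simp only [covRow]
    push_cast
    simp only [Finset.mul_sum, Finset.sum_mul, ← Finset.sum_neg_distrib]
    refine Finset.sum_congr rfl fun k _ => Finset.sum_congr rfl fun v _ => ?_
    have h1 := hS.crossMoment_relation hmn hz k v l w
    rw [IsCenteredLaw.crossMoment_symm (μ := sourceLaw (p m))] at h1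
    have h2 : (z (Sum.inl k) : ℂ) * crossMoment (sourceLaw (p n)) k v l w +
      z (Sum.inr l) * crossMoment (sourceLaw (p m)) l w k v = 0 := by exact_mod_cast h1
    linear_combination Complex.I * u k v * cf (sourceLaw (p m)) u * h2
  rw [e, ← cfEntry] at h
  have hl' : (z (Sum.inr l) : ℂ) ≠ 0 := by exact_mod_cast hl
  refine mul_left_cancel₀ hl' ?_
  linear_combination -h

lemma cfEntry_relation_right (hS : IsSourceModel P p S) (hmn : m ≠ n)
    (hz : ∀ᵐ ω ∂P, ∑ i, z i * pairVector p S m n ω i = 0) (l : Fin K) (hl : z (Sum.inl l) ≠ 0)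
    (w : Fin V) (u : SCM K V) : cfEntry (sourceLaw (p n)) l w u =
      Complex.I * covRow (sourceLaw (p n)) l w u * cf (sourceLaw (p n)) u := by
  have hz' : ∀ᵐ ω ∂P, ∑ i, (z ∘ Sum.swap) i * pairVector p S n m ω i = 0 := by
    filter_upwards [hz] with ω hω
    rw [Fintype.sum_sum_type] at hω ⊢
    rw [← hω, add_comm]
    rfl
  exact hS.cfEntry_relation_left hmn.symm hz' l hl w u

lemma hasMatchingGaussianPair_of_ae [IsProbabilityMeasure P] (hS : IsSourceModel P p S)
    (hmn : m ≠ n) (hz0 : z ≠ 0) (hz : ∀ᵐ ω ∂P, ∑ i, z i * pairVector p S m n ω i = 0) :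
    HasMatchingGaussianPair P S := by
  set a : Fin K → ℝ := fun k => z (Sum.inl k) with ha
  set b : Fin K → ℝ := fun k => z (Sum.inr k) with hb
  have hμ : ∀ n, IsCenteredLaw (sourceLaw (p n)) := fun n => (hS.density n).isCenteredLaw
  obtain ⟨k₀, hk₀⟩ : ∃ k, a k ≠ 0 ∨ b k ≠ 0 := by
    by_contra! hcon
    refine hz0 (funext fun i => ?_)
    cases i with
    | inl k => exact (hcon k).1
    | inr k => exact (hcon k).2
  rcases isEmpty_or_nonempty (Fin V) with hV | ⟨⟨v₀⟩⟩
  · exact hasMatchingGaussianPair_of_splitsGaussian hμ hS.hasLaw hmn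
      (Finset.singleton_nonempty k₀) (splitsGaussian_of_isEmpty _ (hμ m) _)
      (splitsGaussian_of_isEmpty _ (hμ n) _) 1 (by simp) fun _ _ _ _ v => isEmptyElim v
  set Rm := crossMoment (sourceLaw (p m)) with hRm
  set Rn := crossMoment (sourceLaw (p n)) with hRn
  have hrel : ∀ k v l w, a k * Rn k v l w = -(b l * Rm k v l w) := fun k v l w =>
    eq_neg_of_add_eq_zero_left (hS.crossMoment_relation hmn hz k v l w)
  have hrel' : ∀ k v l w, a l * Rn k v l w = -(b k * Rm k v l w) := by
    intro k v l w
    rw [hRm, hRn, IsCenteredLaw.crossMoment_symm k,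
      IsCenteredLaw.crossMoment_symm (μ := sourceLaw (p m)) k]
    exact hrel l w k v
  -- On the diagonal the relation compares two positive variances, so the weights of a row are both
  -- zero or have opposite signs.
  have hc : a k₀ * b k₀ < 0 := by
    have h1 := hrel k₀ v₀ k₀ v₀
    have hm := (hμ m).crossMoment_self_pos k₀ v₀
    have hn := (hμ n).crossMoment_self_pos k₀ v₀
    rw [← hRm] at hm
    rw [← hRn] at hn
    have hb0 : b k₀ ≠ 0 := by
      intro h0
      rw [h0, zero_mul, neg_zero, mul_eq_zero] at h1
      rcases h1 with h1 | h1
      · exact hk₀.elim (fun h => h h1) fun h => h h0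
      · exact hn.ne' h1
    have h2 : a k₀ * b k₀ * Rn k₀ v₀ k₀ v₀ = -(b k₀ ^ 2 * Rm k₀ v₀ k₀ v₀) := by
      linear_combination b k₀ * h1
    have h3 : 0 < b k₀ ^ 2 * Rm k₀ v₀ k₀ v₀ := mul_pos (by positivity) hm
    by_contra hge
    have := mul_nonneg (not_lt.1 hge) hn.le
    linarith
  set c : ℝ := -(a k₀ * b k₀) with hcdef
  have hcpos : 0 < c := by linarith
  -- Together with its transpose, the relation gives `(a k * b k - a l * b l) * Rn = 0`, so the
  -- covariances decouple along level sets of `a * b`. The level set through `k₀` has nonzero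
  -- weights.
  set α : Finset (Fin K) := Finset.univ.filter fun k => a k * b k = -c with hα
  have hmem : ∀ k, k ∈ α ↔ a k * b k = -c := fun k => by simp [hα]
  have hab : ∀ k ∈ α, a k ≠ 0 ∧ b k ≠ 0 := by
    intro k hk
    have := (hmem k).1 hk
    constructor <;> rintro h0 <;> rw [h0] at this <;> simp at this <;> linarith
  have hcross : ∀ k ∈ α, ∀ l ∉ α, ∀ v w, Rn k v l w = 0 ∧ Rm k v l w = 0 := by
    intro k hk l hl v w
    have h1 := hrel k v l w
    have h2 := hrel' k v l w
    have h3 : (a k * b k - a l * b l) * Rn k v l w = 0 := by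
      linear_combination b k * h1 - b l * h2
    have h4 : Rn k v l w = 0 := by
      rcases mul_eq_zero.1 h3 with h | h
      · exact absurd ((hmem l).2 (by linarith [(hmem k).1 hk])) hl
      · exact h
    refine ⟨h4, ?_⟩
    rw [h4, mul_zero, eq_comm, neg_eq_zero, mul_eq_zero] at h2
    exact h2.resolve_left (hab k hk).2
  refine hasMatchingGaussianPair_of_splitsGaussian hμ hS.hasLaw hmn (α := α)
    ⟨k₀, (hmem k₀).2 (by rw [hcdef]; ring)⟩
    ((hμ m).splitsGaussian (fun k hk l hl v w => (hcross k hk l hl v w).2) fun k hk v u _ =>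
      hS.cfEntry_relation_left hmn hz k (hab k hk).2 v u)
    ((hμ n).splitsGaussian (fun k hk l hl v w => (hcross k hk l hl v w).1) fun k hk v u _ =>
      hS.cfEntry_relation_right hmn hz k (hab k hk).1 v u)
    -- On `α` one has `b l = -c / a l`, so `a k * Rn = -(b l * Rm)` becomes `Rm = (a k * a l / c) *
    -- Rn`, which is the required form with `D = a / √c`.
    (fun k => a k / √c) (fun k hk => div_ne_zero (hab k hk).1 (Real.sqrt_pos.2 hcpos).ne') ?_
  intro k hk l hl v w
  rw [← hRm, ← hRn]
  have h1 := hrel k v l w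
  have h2 := (hmem l).1 hl
  have h3 : a k / √c * (a l / √c) = a k * a l / c := by
    rw [div_mul_div_comm, Real.mul_self_sqrt hcpos.le]
  rw [h3]
  field_simp
  linear_combination (-(a l)) * h1 + Rm k v l w * h2

/-- The weights are `d` and `-d⁻¹` on `α`. With linear scores `ψ = Rm⁻¹ x` and `φ = Rn⁻¹ y`, and `E`
the diagonal of `I ⊗ D`, the relation `Rm = E Rn E` gives `E⁻¹ x = Rn (E ψ)`. The two halves of the
combination are then `(E ψ) ⬝ᵥ Rn φ` and `-φ ⬝ᵥ Rn (E ψ)`, which cancel by symmetry of `Rn`. -/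
lemma exists_ae_of_hasMatchingGaussianPair [IsProbabilityMeasure P] (hS : IsSourceModel P p S)
    (h : HasMatchingGaussianPair P S) : ∃ m n : Fin N, m ≠ n ∧ ∃ z : Fin K ⊕ Fin K → ℝ, z ≠ 0 ∧
      ∀ᵐ ω ∂P, ∑ i, z i * pairVector p S m n ω i = 0 := by
  obtain ⟨α, ⟨k₀, hk₀⟩, m, n, hmn, hm, hn, d, hd, hcov⟩ := h
  have hμ : ∀ n, IsCenteredLaw (sourceLaw (p n)) := fun n => (hS.density n).isCenteredLaw
  refine ⟨m, n, hmn, Sum.elim (fun k => if h : k ∈ α then d ⟨k, h⟩ else 0)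
    (fun k => if h : k ∈ α then -(d ⟨k, h⟩)⁻¹ else 0), fun h0 => ?_, ?_⟩
  · have := congrFun h0 (Sum.inl k₀)
    simp [hk₀, hd] at this
  set Rm := covRows P α (S m)
  set Rn := covRows P α (S n)
  have hRm : IsUnit Rm.det := hm.nonsingular
  have hRn : IsUnit Rn.det := hn.nonsingular
  have hRnT : Rnᵀ = Rn := (covRows_posDef (hμ n) (hS.hasLaw n)).isHermitian
  have hsm : ∀ᵐ ω ∂P, ∀ i : Fin V × α,
      score (p m) (S m ω) i.2 i.1 = (Rm⁻¹ *ᵥ vecRows α (S m ω)) i :=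
    ae_all_iff.2 fun i => ae_of_ae_map (hS.hasLaw m).aemeasurable (by
      rw [(hS.hasLaw m).map_eq]
      exact (hS.density m).score_ae_eq (hS.hasLaw m)
        (hm.splitsGaussian (hμ m) (hS.hasLaw m)) i)
  have hsn : ∀ᵐ ω ∂P, ∀ i : Fin V × α,
      score (p n) (S n ω) i.2 i.1 = (Rn⁻¹ *ᵥ vecRows α (S n ω)) i :=
    ae_all_iff.2 fun i => ae_of_ae_map (hS.hasLaw n).aemeasurable (by
      rw [(hS.hasLaw n).map_eq]
      exact (hS.density n).score_ae_eq (hS.hasLaw n)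
        (hn.splitsGaussian (hμ n) (hS.hasLaw n)) i)
  filter_upwards [hsm, hsn] with ω h1 h2
  set x := vecRows α (S m ω)
  set y := vecRows α (S n ω)
  set ψ := Rm⁻¹ *ᵥ x
  set φ := Rn⁻¹ *ᵥ y
  have hx : Rm *ᵥ ψ = x := by rw [mulVec_mulVec, mul_nonsing_inv _ hRm, one_mulVec]
  have hy : Rn *ᵥ φ = y := by rw [mulVec_mulVec, mul_nonsing_inv _ hRn, one_mulVec]
  set E : Fin V × α → ℝ := fun i => d i.2 with hE
  have hRE : Rm = diagonal E * Rn * diagonal E := by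
    rw [hcov, ← diagonal_one, diagonal_kronecker_diagonal]
    simp [hE]
  have hx' : ∀ i, (E i)⁻¹ * x i = (Rn *ᵥ (E * ψ)) i := by
    intro i
    have hEψ : diagonal E *ᵥ ψ = E * ψ := by
      ext j
      rw [mulVec_diagonal, Pi.mul_apply]
    rw [← hx, hRE, ← mulVec_mulVec, ← mulVec_mulVec, hEψ, mulVec_diagonal, ← mul_assoc,
      inv_mul_cancel₀ (hd _), one_mul]
  have key : (E * ψ) ⬝ᵥ y = φ ⬝ᵥ (Rn *ᵥ (E * ψ)) := by
    rw [← hy, dotProduct_mulVec, ← mulVec_transpose, hRnT, dotProduct_comm]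
  have hL : ∑ k, (if h : k ∈ α then d ⟨k, h⟩ else 0) * ∑ v, score (p m) (S m ω) k v * S n ω k v =
      (E * ψ) ⬝ᵥ y := by
    rw [dotProduct, Fintype.sum_prod_type_right, ← Finset.sum_subset (Finset.subset_univ α)
      (fun k _ hk => by simp [hk]), ← Finset.sum_coe_sort α]
    refine Finset.sum_congr rfl fun k _ => ?_
    rw [Finset.mul_sum]
    refine Finset.sum_congr rfl fun v _ => ?_
    rw [dif_pos k.2, Pi.mul_apply, ← h1 (v, k)]
    change d k * (score (p m) (S m ω) k v * S n ω k v) =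
      d k * score (p m) (S m ω) k v * S n ω k v
    ring
  have hR : ∑ k, (if h : k ∈ α then -(d ⟨k, h⟩)⁻¹ else 0) *
      ∑ v, S m ω k v * score (p n) (S n ω) k v = -(φ ⬝ᵥ (Rn *ᵥ (E * ψ))) := by
    rw [dotProduct, Fintype.sum_prod_type_right, ← Finset.sum_subset (Finset.subset_univ α)
      (fun k _ hk => by simp [hk]), ← Finset.sum_coe_sort α, ← Finset.sum_neg_distrib]
    refine Finset.sum_congr rfl fun k _ => ?_
    rw [Finset.mul_sum, ← Finset.sum_neg_distrib]
    refine Finset.sum_congr rfl fun v _ => ?_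
    rw [dif_pos k.2, ← hx', ← h2 (v, k)]
    change -(d k)⁻¹ * (S m ω k v * score (p n) (S n ω) k v) =
      -(score (p n) (S n ω) k v * ((d k)⁻¹ * S m ω k v))
    ring
  rw [Fintype.sum_sum_type]
  simp only [Sum.elim_inl, Sum.elim_inr, pairVector_inl, pairVector_inr]
  rw [hL, hR, key, add_neg_cancel]

theorem exists_singular_fisherBlock_iff [IsProbabilityMeasure P] (hS : IsSourceModel P p S) :
    (∃ m n : Fin N, m ≠ n ∧ ¬ IsUnit (fisherBlock P p S m n).det) ↔
      HasMatchingGaussianPair P S := by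
  constructor
  · rintro ⟨m, n, hmn, h⟩
    obtain ⟨z, hz0, hz⟩ := (hS.not_isUnit_det_fisherBlock_iff hmn).1 h
    exact hS.hasMatchingGaussianPair_of_ae hmn hz0 hz
  · intro h
    obtain ⟨m, n, hmn, z, hz0, hz⟩ := hS.exists_ae_of_hasMatchingGaussianPair h
    exact ⟨m, n, hmn, (hS.not_isUnit_det_fisherBlock_iff hmn).2 ⟨z, hz0, hz⟩⟩

end IsSourceModel

/-! ### Mixtures that preserve independence -/

/-- The linear mixture of sources, arranged by sources. -/
def mixRows {N K V : ℕ} (B : Fin K → Matrix (Fin N) (Fin N) ℝ) (s : Fin N → SCM K V) :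
    Fin N → SCM K V := fun n k v => ∑ m, B k n m * s m k v

section mixRows

variable {N K V : ℕ}

lemma mix_apply (A : Fin K → Matrix (Fin N) (Fin N) ℝ) (s : Fin N → SCM K V) (k : Fin K)
    (n : Fin N) (v : Fin V) : mix A s k n v = mixRows A s n k v := rfl

lemma mixRows_mixRows (A B : Fin K → Matrix (Fin N) (Fin N) ℝ) (s : Fin N → SCM K V) :
    mixRows A (mixRows B s) = mixRows (fun k => A k * B k) s := by
  ext n k v
  simp only [mixRows, Matrix.mul_apply, Finset.mul_sum, Finset.sum_mul]
  rw [Finset.sum_comm]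
  exact Finset.sum_congr rfl fun i _ => Finset.sum_congr rfl fun j _ => by ring

lemma mixRows_one (s : Fin N → SCM K V) : mixRows (fun _ => 1) s = s := by
  ext n k v
  simp [mixRows, Matrix.one_apply]

lemma mixRows_eq_self {B : Fin K → Matrix (Fin N) (Fin N) ℝ} (hB : ∀ k, B k = 1)
    (s : Fin N → SCM K V) : mixRows B s = s := by
  rw [funext hB, mixRows_one]

lemma mixRows_transpose_cancel {B W : Fin K → Matrix (Fin N) (Fin N) ℝ} (h : ∀ k, W k * B k = 1)
    (s : Fin N → SCM K V) :
    mixRows (fun k => (B k)ᵀ) (mixRows (fun k => (W k)ᵀ) s) = s := by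
  rw [mixRows_mixRows]
  exact mixRows_eq_self (fun k => by rw [← transpose_mul, h, transpose_one]) s

lemma continuous_mixRows (B : Fin K → Matrix (Fin N) (Fin N) ℝ) :
    Continuous (mixRows B : (Fin N → SCM K V) → Fin N → SCM K V) := by
  unfold mixRows
  fun_prop

lemma sum_pairing_mixRows (B : Fin K → Matrix (Fin N) (Fin N) ℝ) (u s : Fin N → SCM K V) :
    ∑ n, pairing (u n) (mixRows B s n) = ∑ j, pairing (mixRows (fun k => (B k)ᵀ) u j) (s j) := by
  simp only [pairing, mixRows, Finset.mul_sum, Finset.sum_mul, transpose_apply]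
  rw [Finset.sum_comm]
  conv_rhs => rw [Finset.sum_comm]
  refine Finset.sum_congr rfl fun k _ => ?_
  rw [Finset.sum_comm]
  conv_rhs => rw [Finset.sum_comm]
  refine Finset.sum_congr rfl fun v _ => ?_
  rw [Finset.sum_comm]
  exact Finset.sum_congr rfl fun i _ => Finset.sum_congr rfl fun j _ => by ring

lemma prod_wave (u s : Fin N → SCM K V) :
    ∏ n, wave (u n) (s n) = Complex.exp ((∑ n, pairing (u n) (s n) : ℝ) * Complex.I) := by
  simp only [wave]
  rw [← Complex.exp_sum, ← Finset.sum_mul, ← Complex.ofReal_sum]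

lemma prod_wave_mixRows (B : Fin K → Matrix (Fin N) (Fin N) ℝ) (u s : Fin N → SCM K V) :
    ∏ n, wave (u n) (mixRows B s n) = ∏ j, wave (mixRows (fun k => (B k)ᵀ) u j) (s j) := by
  rw [prod_wave, prod_wave, sum_pairing_mixRows]

lemma continuous_prod_wave (u : Fin N → SCM K V) :
    Continuous fun s : Fin N → SCM K V => ∏ n, wave (u n) (s n) :=
  continuous_finsetProd _ fun n _ => (continuous_wave (u n)).comp (continuous_apply n)

variable {μ μ' : Fin N → Measure (SCM K V)} {B W : Fin K → Matrix (Fin N) (Fin N) ℝ}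

lemma integral_prod_wave (hμ : ∀ n, IsCenteredLaw (μ n)) (u : Fin N → SCM K V) :
    ∫ s, ∏ n, wave (u n) (s n) ∂(Measure.pi μ) = ∏ n, cf (μ n) (u n) := by
  have := fun n => (hμ n).isProb
  exact integral_fintype_prod_eq_prod (fun n => wave (u n))

lemma integral_entry_mul_prod_wave (hμ : ∀ n, IsCenteredLaw (μ n)) (u : Fin N → SCM K V)
    (hu : ∀ n, cf (μ n) (u n) ≠ 0) (n : Fin N) (k : Fin K) (v : Fin V) :
    ∫ s : Fin N → SCM K V, (s n k v : ℂ) * ∏ n, wave (u n) (s n) ∂(Measure.pi μ) =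
      cfEntry (μ n) k v (u n) / cf (μ n) (u n) * ∏ n, cf (μ n) (u n) := by
  have := fun n => (hμ n).isProb
  have e : ∀ s : Fin N → SCM K V, (s n k v : ℂ) * ∏ n, wave (u n) (s n) =
      ∏ m, ((if m = n then (s m k v : ℂ) else 1) * wave (u m) (s m)) := by
    intro s
    rw [Finset.prod_mul_distrib]
    simp
  simp only [e]
  rw [integral_fintype_prod_eq_prod
    (fun m (x : SCM K V) => (if m = n then (x k v : ℂ) else 1) * wave (u m) x),
    ← Finset.mul_prod_erase _ _ (Finset.mem_univ n),
    ← Finset.mul_prod_erase Finset.univ (fun n => cf (μ n) (u n)) (Finset.mem_univ n), ← mul_assoc,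
    div_mul_cancel₀ _ (hu n)]
  congr 1
  · simp [cfEntry]
  · refine Finset.prod_congr rfl fun m hm => ?_
    simp [Finset.ne_of_mem_erase hm, cf]

lemma integral_eval (hμ : ∀ n, IsCenteredLaw (μ n)) (n : Fin N) {f : SCM K V → ℝ}
    (hf : AEStronglyMeasurable f (μ n)) :
    ∫ s, f (s n) ∂(Measure.pi μ) = ∫ x, f x ∂(μ n) := by
  have := fun n => (hμ n).isProb
  have h := measurePreserving_eval μ n
  rw [← h.map_eq, integral_map h.measurable.aemeasurable (by rwa [h.map_eq])]

lemma memLp_eval (hμ : ∀ n, IsCenteredLaw (μ n)) (n : Fin N) (k : Fin K) (v : Fin V) :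
    MemLp (fun s : Fin N → SCM K V => s n k v) 2 (Measure.pi μ) := by
  have := fun n => (hμ n).isProb
  exact ((hμ n).memLp k v).comp_measurePreserving (measurePreserving_eval μ n)

lemma integral_entry_mul_entry (hμ : ∀ n, IsCenteredLaw (μ n)) (m n : Fin N) (k : Fin K)
    (v : Fin V) (l : Fin K) (w : Fin V) :
    ∫ s : Fin N → SCM K V, s m k v * s n l w ∂(Measure.pi μ) =
      if m = n then crossMoment (μ n) k v l w else 0 := by
  have := fun n => (hμ n).isProb
  split_ifs with hmn
  · subst hmn
    exact integral_eval hμ m (f := fun x => x k v * x l w)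
      (Continuous.aestronglyMeasurable (by fun_prop))
  · have e : ∀ s : Fin N → SCM K V, s m k v * s n l w =
        ∏ j, ((if j = m then s j k v else 1) * (if j = n then s j l w else 1)) := by
      intro s
      rw [Finset.prod_mul_distrib]
      simp
    simp only [e]
    rw [integral_fintype_prod_eq_prod
      (fun j (x : SCM K V) => (if j = m then x k v else 1) * (if j = n then x l w else 1))]
    refine Finset.prod_eq_zero (Finset.mem_univ m) ?_
    simp [hmn, (hμ m).mean_zero]

lemma integral_entry_mul_sum_pairing (hμ : ∀ n, IsCenteredLaw (μ n)) (u : Fin N → SCM K V)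
    (n : Fin N) (k : Fin K) (v : Fin V) :
    ∫ s : Fin N → SCM K V, s n k v * ∑ m, pairing (u m) (s m) ∂(Measure.pi μ) =
      covRow (μ n) k v (u n) := by
  have e : ∀ s : Fin N → SCM K V, s n k v * ∑ m, pairing (u m) (s m) =
      ∑ m, ∑ l, ∑ w, u m l w * (s n k v * s m l w) := by
    intro s
    simp only [pairing, Finset.mul_sum]
    exact Finset.sum_congr rfl fun m _ => Finset.sum_congr rfl fun l _ =>
      Finset.sum_congr rfl fun w _ => by ring
  have I : ∀ m l w, Integrable (fun s : Fin N → SCM K V => u m l w * (s n k v * s m l w))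
      (Measure.pi μ) := fun m l w =>
    ((memLp_eval hμ n k v).integrable_mul (memLp_eval hμ m l w)).const_mul _
  simp only [e]
  rw [integral_finsetSum _ fun m _ => integrable_finsetSum _ fun l _ => integrable_finsetSum _
    fun w _ => I m l w, Finset.sum_eq_single n]
  · rw [integral_finsetSum _ fun l _ => integrable_finsetSum _ fun w _ => I n l w, covRow]
    refine Finset.sum_congr rfl fun l _ => ?_
    rw [integral_finsetSum _ fun w _ => I n l w]
    refine Finset.sum_congr rfl fun w _ => ?_
    rw [integral_const_mul, integral_entry_mul_entry hμ, if_pos rfl, mul_comm]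
  · intro m _ hm
    rw [integral_finsetSum _ fun l _ => integrable_finsetSum _ fun w _ => I m l w]
    refine Finset.sum_eq_zero fun l _ => ?_
    rw [integral_finsetSum _ fun w _ => I m l w]
    refine Finset.sum_eq_zero fun w _ => ?_
    rw [integral_const_mul, integral_entry_mul_entry hμ, if_neg hm.symm, mul_zero]
  · exact fun h => absurd (Finset.mem_univ n) h

lemma integral_map_mixRows {E : Type*} [NormedAddCommGroup E] [NormedSpace ℝ E]
    [SecondCountableTopology E]
    (hB : (Measure.pi μ').map (mixRows B) = Measure.pi μ) {f : (Fin N → SCM K V) → E}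
    (hf : Continuous f) :
    ∫ s, f s ∂(Measure.pi μ) = ∫ s, f (mixRows B s) ∂(Measure.pi μ') := by
  rw [← hB, integral_map (continuous_mixRows B).measurable.aemeasurable hf.aestronglyMeasurable]

lemma prod_cf_mixRows (hμ : ∀ n, IsCenteredLaw (μ n)) (hμ' : ∀ n, IsCenteredLaw (μ' n))
    (hB : (Measure.pi μ').map (mixRows B) = Measure.pi μ) (u : Fin N → SCM K V) :
    ∏ n, cf (μ n) (u n) = ∏ j, cf (μ' j) (mixRows (fun k => (B k)ᵀ) u j) := by
  rw [← integral_prod_wave hμ, ← integral_prod_wave hμ',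
    integral_map_mixRows hB (continuous_prod_wave u)]
  simp only [prod_wave_mixRows]

lemma cf_ne_zero_iff (hμ : ∀ n, IsCenteredLaw (μ n)) (hμ' : ∀ n, IsCenteredLaw (μ' n))
    (hB : (Measure.pi μ').map (mixRows B) = Measure.pi μ) (u : Fin N → SCM K V) :
    (∀ n, cf (μ n) (u n) ≠ 0) ↔ ∀ j, cf (μ' j) (mixRows (fun k => (B k)ᵀ) u j) ≠ 0 := by
  have := prod_cf_mixRows hμ hμ' hB u
  have h : (∏ n, cf (μ n) (u n) ≠ 0) ↔ ∏ j, cf (μ' j) (mixRows (fun k => (B k)ᵀ) u j) ≠ 0 := by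
    rw [this]
  simpa [Finset.prod_ne_zero_iff] using h

lemma covRow_mixRows (hμ : ∀ n, IsCenteredLaw (μ n)) (hμ' : ∀ n, IsCenteredLaw (μ' n))
    (hB : (Measure.pi μ').map (mixRows B) = Measure.pi μ) (u : Fin N → SCM K V) (n : Fin N)
    (k : Fin K) (v : Fin V) : covRow (μ n) k v (u n) =
      ∑ j, B k n j * covRow (μ' j) k v (mixRows (fun k => (B k)ᵀ) u j) := by
  rw [← integral_entry_mul_sum_pairing hμ, integral_map_mixRows hB (by unfold pairing; fun_prop)]
  simp only [sum_pairing_mixRows]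
  set t := mixRows (fun k => (B k)ᵀ) u
  have e : ∀ s : Fin N → SCM K V, mixRows B s n k v * ∑ j, pairing (t j) (s j) =
      ∑ j, B k n j * (s j k v * ∑ i, pairing (t i) (s i)) := by
    intro s
    simp only [mixRows, Finset.sum_mul, mul_assoc]
  simp only [e]
  rw [integral_finsetSum]
  · simp only [integral_const_mul, integral_entry_mul_sum_pairing hμ']
  · intro j _
    refine Integrable.const_mul ?_ _
    have hs : MemLp (fun s : Fin N → SCM K V => ∑ i, pairing (t i) (s i)) 2 (Measure.pi μ') :=
      memLp_finsetSum _ fun i _ => memLp_finsetSum _ fun l _ => memLp_finsetSum _ fun w _ =>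
        (memLp_eval hμ' i l w).const_mul _
    exact (memLp_eval hμ' j k v).integrable_mul hs

/-- This is the logarithmic derivative of `prod_cf_mixRows`, obtained without differentiating: the
integral of an entry times the product character is computed on both sides, the entry being linear
in the other sources. -/
lemma logDeriv_cf_mixRows (hμ : ∀ n, IsCenteredLaw (μ n)) (hμ' : ∀ n, IsCenteredLaw (μ' n))
    (hB : (Measure.pi μ').map (mixRows B) = Measure.pi μ) (u : Fin N → SCM K V)
    (hu : ∀ n, cf (μ n) (u n) ≠ 0) (n : Fin N) (k : Fin K) (v : Fin V) :
    cfEntry (μ n) k v (u n) / cf (μ n) (u n) =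
      ∑ j, (B k n j : ℂ) * (cfEntry (μ' j) k v (mixRows (fun k => (B k)ᵀ) u j) /
        cf (μ' j) (mixRows (fun k => (B k)ᵀ) u j)) := by
  have := fun n => (hμ n).isProb
  have := fun n => (hμ' n).isProb
  have hu' := (cf_ne_zero_iff hμ hμ' hB u).1 hu
  have hprod : ∏ n, cf (μ n) (u n) ≠ 0 := Finset.prod_ne_zero_iff.2 fun n _ => hu n
  have hc : Continuous fun s : Fin N → SCM K V => (s n k v : ℂ) * ∏ n, wave (u n) (s n) := by
    have := continuous_prod_wave u
    fun_prop
  refine mul_right_cancel₀ hprod ?_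
  rw [← integral_entry_mul_prod_wave hμ u hu, integral_map_mixRows hB hc, Finset.sum_mul,
    prod_cf_mixRows hμ hμ' hB]
  simp only [prod_wave_mixRows]
  set t := mixRows (fun k => (B k)ᵀ) u
  have e : ∀ s : Fin N → SCM K V, (mixRows B s n k v : ℂ) * ∏ j, wave (t j) (s j) =
      ∑ j, (B k n j : ℂ) * ((s j k v : ℂ) * ∏ i, wave (t i) (s i)) := by
    intro s
    simp only [mixRows, Complex.ofReal_sum, Complex.ofReal_mul, Finset.sum_mul, mul_assoc]
  simp only [e]
  rw [integral_finsetSum]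
  · simp only [integral_const_mul, integral_entry_mul_prod_wave hμ' t hu', mul_assoc]
  · intro j _
    refine Integrable.const_mul ?_ _
    have hs : MemLp (fun s : Fin N → SCM K V => ∏ i, wave (t i) (s i)) 2 (Measure.pi μ') :=
      MemLp.of_bound (continuous_prod_wave t).aestronglyMeasurable 1
        (Eventually.of_forall fun s => by simp [norm_wave])
    exact (memLp_eval hμ' j k v).ofReal.integrable_mul hs

lemma logDeviation_mixRows (hμ : ∀ n, IsCenteredLaw (μ n)) (hμ' : ∀ n, IsCenteredLaw (μ' n))
    (hB : (Measure.pi μ').map (mixRows B) = Measure.pi μ) (u : Fin N → SCM K V)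
    (hu : ∀ n, cf (μ n) (u n) ≠ 0) (n : Fin N) (k : Fin K) (v : Fin V) :
    logDeviation (μ n) k v (u n) =
      ∑ j, (B k n j : ℂ) * logDeviation (μ' j) k v (mixRows (fun k => (B k)ᵀ) u j) := by
  simp only [logDeviation, mul_sub, Finset.sum_sub_distrib]
  rw [← logDeriv_cf_mixRows hμ hμ' hB u hu, covRow_mixRows hμ hμ' hB u]
  push_cast
  rw [Finset.mul_sum]
  congr 1
  exact Finset.sum_congr rfl fun j _ => by ring

lemma map_mixRows_symm (hB : (Measure.pi μ').map (mixRows B) = Measure.pi μ)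
    (hWB : ∀ k, W k * B k = 1) : (Measure.pi μ).map (mixRows W) = Measure.pi μ' := by
  rw [← hB, Measure.map_map (continuous_mixRows W).measurable (continuous_mixRows B).measurable]
  have : (mixRows W ∘ mixRows B : (Fin N → SCM K V) → _) = id := by
    ext1 s
    rw [Function.comp_apply, mixRows_mixRows, mixRows_eq_self hWB, id]
  rw [this, Measure.map_id]

lemma logDeviation_zero {ν : Measure (SCM K V)} (h : IsCenteredLaw ν) (k : Fin K) (v : Fin V) :
    logDeviation ν k v 0 = 0 := by
  simp [logDeviation, h.cfEntry_zero, covRow]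

/-- The covariances of two source vectors related by a mixture are intertwined. -/
lemma crossMoment_mixRows (hμ : ∀ n, IsCenteredLaw (μ n)) (hμ' : ∀ n, IsCenteredLaw (μ' n))
    (hB : (Measure.pi μ').map (mixRows B) = Measure.pi μ) (hWB : ∀ k, W k * B k = 1)
    (n i : Fin N) (k : Fin K) (v : Fin V) (l : Fin K) (w : Fin V) :
    W l i n * crossMoment (μ n) k v l w = B k n i * crossMoment (μ' i) k v l w := by
  have hrow : ∀ (ν : Measure (SCM K V)) (c : ℝ),
      covRow ν k v (c • entryDir l w) = c * crossMoment ν k v l w := by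
    intro ν c
    simp [covRow, entryDir, Pi.single_apply, ite_apply, mul_comm]
  set t : Fin N → SCM K V := Pi.single i (entryDir l w) with ht
  have h := covRow_mixRows hμ hμ' hB (mixRows (fun k => (W k)ᵀ) t) n k v
  rw [mixRows_transpose_cancel hWB] at h
  have e1 : mixRows (fun k => (W k)ᵀ) t n = W l i n • entryDir l w := by
    ext k' v'
    simp only [mixRows, transpose_apply, Pi.smul_apply, smul_eq_mul]
    rw [Finset.sum_eq_single i (fun j _ hj => by simp [ht, hj]) (by simp)]
    simp only [ht, Pi.single_eq_same, entryDir]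
    by_cases hk : k' = l
    · rw [hk]
    · simp [hk]
  rw [e1, hrow, Finset.sum_eq_single i (fun j _ hj => by simp [ht, hj, covRow]) (by simp)] at h
  have := hrow (μ' i) 1
  rw [one_smul, one_mul] at this
  simpa [ht, this] using h

/-- The deviation of the logarithmic derivative from the normal case is multiplicative along the
row contractions given by sums of products of entries of two mutually inverse mixtures. -/
lemma logDeviation_scaleRows (hμ : ∀ n, IsCenteredLaw (μ n)) (hμ' : ∀ n, IsCenteredLaw (μ' n))
    (hB : (Measure.pi μ').map (mixRows B) = Measure.pi μ) (hWB : ∀ k, W k * B k = 1) (n : Fin N)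
    (J : Finset (Fin N)) (k : Fin K) (v : Fin V) {u : SCM K V} (hu : cf (μ n) u ≠ 0) :
    cf (μ n) (scaleRows (fun k => ∑ j ∈ J, W k j n * B k n j) u) ≠ 0 ∧
      logDeviation (μ n) k v (scaleRows (fun k => ∑ j ∈ J, W k j n * B k n j) u) =
        ((∑ j ∈ J, W k j n * B k n j : ℝ) : ℂ) * logDeviation (μ n) k v u := by
  have hW := map_mixRows_symm hB hWB
  have hBW : ∀ k, B k * W k = 1 := fun k => mul_eq_one_comm.1 (hWB k)
  -- A frequency in source `n` alone becomes `t j = B n j * u` row by row, and the deviation of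
  -- source `j` there is a multiple of the one at `u`.
  set u₁ : Fin N → SCM K V := Pi.single n u with hu₁
  have hu₁c : ∀ m, cf (μ m) (u₁ m) ≠ 0 := by
    intro m
    by_cases hm : m = n
    · subst hm
      simpa [hu₁] using hu
    · simp [hu₁, hm, (hμ m).cf_zero]
  set t := mixRows (fun k => (B k)ᵀ) u₁ with ht
  have htc := (cf_ne_zero_iff hμ hμ' hB u₁).1 hu₁c
  have htL : ∀ j, logDeviation (μ' j) k v (t j) = W k j n * logDeviation (μ n) k v u := by
    intro j
    have h := logDeviation_mixRows hμ' hμ hW t htc j k v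
    rw [ht, mixRows_transpose_cancel hBW] at h
    rw [ht, h, Finset.sum_eq_single n (fun m _ hm => by simp [hu₁, hm, logDeviation_zero (hμ m)])
      (by simp)]
    simp [hu₁]
  -- The frequencies of the other sources may be chosen freely, and zero is harmless: there the
  -- characteristic function is one and the deviation vanishes. Passing back to source `n` gives the
  -- partial sums over `J`.
  set tJ : Fin N → SCM K V := fun j => if j ∈ J then t j else 0 with htJ
  set u₂ := mixRows (fun k => (W k)ᵀ) tJ with hu₂
  have hback : mixRows (fun k => (B k)ᵀ) u₂ = tJ := mixRows_transpose_cancel hWB tJ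
  have hu₂c : ∀ m, cf (μ m) (u₂ m) ≠ 0 := by
    refine (cf_ne_zero_iff hμ hμ' hB u₂).2 fun j => ?_
    rw [hback]
    by_cases hj : j ∈ J
    · simpa [htJ, hj] using htc j
    · simp [htJ, hj, (hμ' j).cf_zero]
  have hu₂n : u₂ n = scaleRows (fun k => ∑ j ∈ J, W k j n * B k n j) u := by
    ext k' v'
    have htj : ∀ j, t j k' v' = B k' n j * u k' v' := by
      intro j
      simp only [ht, mixRows, transpose_apply]
      rw [Finset.sum_eq_single n (fun m _ hm => by simp [hu₁, hm]) (by simp)]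
      simp [hu₁]
    simp only [hu₂, mixRows, transpose_apply, scaleRows, htJ, Finset.sum_mul]
    rw [← Finset.sum_subset (Finset.subset_univ J) (fun j _ hj => by simp [hj])]
    refine Finset.sum_congr rfl fun j hj => ?_
    rw [if_pos hj, htj]
    ring
  have hmain := logDeviation_mixRows hμ hμ' hB u₂ hu₂c n k v
  rw [hback, hu₂n] at hmain
  refine ⟨hu₂n ▸ hu₂c n, ?_⟩
  rw [hmain, ← Finset.sum_subset (Finset.subset_univ J)
    (fun j _ hj => by simp [htJ, hj, logDeviation_zero (hμ' j)]), Complex.ofReal_sum,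
    Finset.sum_mul]
  refine Finset.sum_congr rfl fun j hj => ?_
  simp only [htJ, if_pos hj, htL]
  push_cast
  ring

end mixRows

/-! ### Nonidentifiability forces matching normal factors -/

/-- An invertible matrix that is not a diagonal matrix times a permutation matrix has two nonzero
entries in some column. -/
lemma exists_two_ne_zero_of_not_monomial {N : ℕ} {B : Matrix (Fin N) (Fin N) ℝ} (hB : IsUnit B.det)
    (h : ¬ ∃ (l : Fin N → ℝ) (σ : Equiv.Perm (Fin N)), (∀ n, l n ≠ 0) ∧
      B = diagonal l * σ.permMatrix ℝ) :
    ∃ i m n, m ≠ n ∧ B m i ≠ 0 ∧ B n i ≠ 0 := by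
  by_contra! hcon
  apply h
  have hdet := hB.ne_zero
  rw [det_apply] at hdet
  -- A nonzero term of the Leibniz expansion selects one nonzero entry in each column; by assumption
  -- it is the only one there.
  obtain ⟨τ, -, hτ⟩ := Finset.exists_ne_zero_of_sum_ne_zero hdet
  have hτ' : ∀ i, B (τ i) i ≠ 0 := fun i hi =>
    hτ (by
      have h0 : ∏ j, B (τ j) j = 0 := Finset.prod_eq_zero (Finset.mem_univ i) hi
      rw [h0, smul_zero])
  refine ⟨fun n => B n (τ.symm n), τ.symm, fun n => by simpa using hτ' (τ.symm n), ?_⟩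
  ext n i
  rw [diagonal_mul, Equiv.Perm.permMatrix, PEquiv.toMatrix_apply]
  by_cases hi : τ.symm n = i
  · simp [hi]
  · have hne : τ i ≠ n := fun h => hi (by rw [← h, Equiv.symm_apply_apply])
    have : B n i = 0 := hcon i (τ i) n hne (hτ' i)
    simp [this, hi]

section identifiability

variable {N K V : ℕ} {Ω : Type*} [MeasurableSpace Ω] {P : Measure Ω}
  {p : Fin N → SCM K V → ℝ} {S : Fin N → Ω → SCM K V}

lemma IsSourceModel.map_eq_pi [IsProbabilityMeasure P] (hS : IsSourceModel P p S) :
    P.map (fun ω n => S n ω) = Measure.pi fun n => sourceLaw (p n) := by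
  rw [(iIndepFun_iff_map_fun_eq_pi_map fun n => (hS.hasLaw n).aemeasurable).1 hS.indep]
  congr 1
  ext1 n
  exact (hS.hasLaw n).map_eq

lemma continuous_mix (A : Fin K → Matrix (Fin N) (Fin N) ℝ) :
    Continuous (mix A : (Fin N → SCM K V) → _) := by
  have h := continuous_mixRows (V := V) A
  refine continuous_pi fun k => continuous_pi fun n => continuous_pi fun v => ?_
  simp only [mix_apply]
  fun_prop

lemma IsSourceModel.map_mix [IsProbabilityMeasure P] (hS : IsSourceModel P p S)
    (A : Fin K → Matrix (Fin N) (Fin N) ℝ) :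
    P.map (fun ω => mix A fun n => S n ω) = observationLaw A p := by
  rw [observationLaw, ← hS.map_eq_pi, AEMeasurable.map_map_of_aemeasurable
    (continuous_mix A).measurable.aemeasurable
    (aemeasurable_pi_lambda _ fun n => (hS.hasLaw n).aemeasurable)]
  rfl

/-- Equality of observation laws in terms of the unmixed sources. -/
lemma map_mixRows_of_observationLaw_eq {p' : Fin N → SCM K V → ℝ}
    {A A' : Fin K → Matrix (Fin N) (Fin N) ℝ} (hA : ∀ k, IsUnit (A k).det)
    (h : observationLaw A' p' = observationLaw A p) :
    (Measure.pi fun n => sourceLaw (p' n)).map (mixRows fun k => (A k)⁻¹ * A' k) =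
      Measure.pi fun n => sourceLaw (p n) := by
  set g : (Fin K → Fin N → Fin V → ℝ) → Fin N → SCM K V :=
    fun y => mixRows (fun k => (A k)⁻¹) fun n k v => y k n v with hg
  have hgm : Measurable g := by
    refine (continuous_mixRows _).measurable.comp (Continuous.measurable ?_)
    fun_prop
  have hcomp : ∀ C : Fin K → Matrix (Fin N) (Fin N) ℝ,
      g ∘ mix C = mixRows fun k => (A k)⁻¹ * C k := by
    intro C
    ext1 s
    exact mixRows_mixRows (fun k => (A k)⁻¹) C s
  have h2 := congrArg (Measure.map g) h
  rw [observationLaw, observationLaw, Measure.map_map hgm (continuous_mix _).measurable,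
    Measure.map_map hgm (continuous_mix _).measurable, hcomp, hcomp] at h2
  rw [h2]
  have : (mixRows (fun k => (A k)⁻¹ * A k) : (Fin N → SCM K V) → _) = id := by
    ext1 s
    exact mixRows_eq_self (fun k => nonsing_inv_mul _ (hA k)) s
  rw [this, Measure.map_id]

/-- If the mixture of independent sources by invertible matrices with two nonzero entries in one
column has independent components, then two of these share a normal factor. -/
lemma hasMatchingGaussianPair_of_mixRows [IsProbabilityMeasure P]
    {μ μ' : Fin N → Measure (SCM K V)} (hμ : ∀ n, IsCenteredLaw (μ n))
    (hμ' : ∀ n, IsCenteredLaw (μ' n)) (hS : ∀ n, HasLaw (S n) (μ n) P)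
    {B W : Fin K → Matrix (Fin N) (Fin N) ℝ}
    (hB : (Measure.pi μ').map (mixRows B) = Measure.pi μ) (hWB : ∀ k, W k * B k = 1)
    {k₀ : Fin K} {i m n : Fin N} (hmn : m ≠ n) (hm : B k₀ m i ≠ 0) (hn : B k₀ n i ≠ 0) :
    HasMatchingGaussianPair P S := by
  rcases isEmpty_or_nonempty (Fin V) with hV | ⟨⟨v₀⟩⟩
  · exact hasMatchingGaussianPair_of_splitsGaussian hμ hS hmn
      (Finset.singleton_nonempty k₀) (splitsGaussian_of_isEmpty _ (hμ m) _)
      (splitsGaussian_of_isEmpty _ (hμ n) _) 1 (by simp) fun _ _ _ _ v => isEmptyElim v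
  have hBW : ∀ k, B k * W k = 1 := fun k => mul_eq_one_comm.1 (hWB k)
  have hrel := crossMoment_mixRows hμ hμ' hB hWB
  have hrel' : ∀ n i k v l w,
      W k i n * crossMoment (μ n) k v l w = B l n i * crossMoment (μ' i) k v l w := by
    intro n i k v l w
    rw [IsCenteredLaw.crossMoment_symm k, IsCenteredLaw.crossMoment_symm (μ := μ' i) k]
    exact hrel n i l w k v
  -- Covariance intertwining on the diagonal reads `W * variance = B * variance'` with positive
  -- variances, so corresponding entries of `W` and `B` have the same sign.
  have hpos : ∀ k j r, 0 ≤ W k j r * B k r j ∧ (B k r j ≠ 0 → 0 < W k j r * B k r j) := by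
    intro k j r
    have h1 := hrel r j k v₀ k v₀
    have h2 := (hμ r).crossMoment_self_pos k v₀
    have h3 := (hμ' j).crossMoment_self_pos k v₀
    have h4 : W k j r * B k r j =
        B k r j ^ 2 * (crossMoment (μ' j) k v₀ k v₀ / crossMoment (μ r) k v₀ k v₀) := by
      field_simp
      linear_combination B k r j * h1
    rw [h4]
    exact ⟨by positivity, fun h => by positivity⟩
  -- For each `k` these are probability weights over `r`, since `W k * B k = 1`. Two of them are
  -- positive at `k₀`, hence both lie strictly between zero and one.
  set x : Fin N → Fin K → ℝ := fun r k => W k i r * B k r i with hx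
  have hsum : ∀ k, ∑ r, x r k = 1 := by
    intro k
    have := congrFun (congrFun (hWB k) i) i
    rwa [Matrix.mul_apply, one_apply_eq] at this
  have hsum' : ∀ k r, ∑ j, W k j r * B k r j = 1 := by
    intro k r
    have := congrFun (congrFun (hBW k) r) r
    rw [Matrix.mul_apply, one_apply_eq] at this
    rw [← this]
    exact Finset.sum_congr rfl fun j _ => mul_comm _ _
  have hxmn : ∀ k, x m k + x n k ≤ 1 := by
    intro k
    rw [← hsum k, ← Finset.sum_pair (f := fun r => x r k) hmn]
    exact Finset.sum_le_sum_of_subset_of_nonneg (Finset.subset_univ _) fun r _ _ => (hpos k i r).1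
  have hx0 : ∀ r k, 0 ≤ x r k := fun r k => (hpos k i r).1
  have hx1 : ∀ r k, x r k ≤ 1 := fun r k => by
    rw [← hsum k]
    exact Finset.single_le_sum (f := fun r => x r k) (fun r _ => (hpos k i r).1)
      (Finset.mem_univ r)
  have hxm : 0 < x m k₀ := (hpos k₀ i m).2 hm
  have hxn : 0 < x n k₀ := (hpos k₀ i n).2 hn
  -- Nonzero covariance between rows `k` and `l` of source `r` forces `x r k = x r l`. Covariances
  -- of both sources are multiples of those of source `i` of `μ'`, so on `α` a nonzero one for
  -- either source is nonzero for both; hence neither source couples `α` to its complement.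
  set α : Finset (Fin K) := Finset.univ.filter fun k => x m k = x m k₀ ∧ x n k = x n k₀ with hα
  have hmem : ∀ k, k ∈ α ↔ x m k = x m k₀ ∧ x n k = x n k₀ := fun k => by simp [hα]
  have hne : ∀ k r, 0 < x r k → W k i r ≠ 0 ∧ B k r i ≠ 0 := fun k r h =>
    ⟨left_ne_zero_of_mul h.ne', right_ne_zero_of_mul h.ne'⟩
  have heq : ∀ r k v l w, crossMoment (μ r) k v l w ≠ 0 → x r k = x r l := by
    intro r k v l w h0
    refine mul_right_cancel₀ h0 ?_
    simp only [hx]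
    linear_combination B k r i * hrel' r i k v l w - B l r i * hrel r i k v l w
  have htransfer : ∀ r s k v l w, 0 < x r k → 0 < x s k → crossMoment (μ r) k v l w ≠ 0 →
      crossMoment (μ s) k v l w ≠ 0 := by
    intro r s k v l w hr hs h0
    have h1 := hrel' r i k v l w
    have h2 : crossMoment (μ' i) k v l w ≠ 0 :=
      right_ne_zero_of_mul (h1 ▸ mul_ne_zero (hne k r hr).1 h0)
    have h3 := hrel s i k v l w
    exact right_ne_zero_of_mul (h3.symm ▸ mul_ne_zero (hne k s hs).2 h2)
  have hαpos : ∀ k ∈ α, 0 < x m k ∧ 0 < x n k := fun k hk => by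
    rw [((hmem k).1 hk).1, ((hmem k).1 hk).2]
    exact ⟨hxm, hxn⟩
  have hcross : ∀ k ∈ α, ∀ l ∉ α, ∀ v w,
      crossMoment (μ m) k v l w = 0 ∧ crossMoment (μ n) k v l w = 0 := by
    intro k hk l hl v w
    have hkp := hαpos k hk
    have hnot : ¬ (crossMoment (μ m) k v l w ≠ 0 ∧ crossMoment (μ n) k v l w ≠ 0) := by
      rintro ⟨h1, h2⟩
      refine hl ((hmem l).2 ⟨?_, ?_⟩)
      · rw [← heq m k v l w h1, ((hmem k).1 hk).1]
      · rw [← heq n k v l w h2, ((hmem k).1 hk).2]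
    constructor
    · by_contra h
      exact hnot ⟨h, htransfer m n k v l w hkp.1 hkp.2 h⟩
    · by_contra h
      exact hnot ⟨htransfer n m k v l w hkp.2 hkp.1 h, h⟩
  have hlin : ∀ r, ∀ k v u, 0 < x r k → x r k < 1 → cf (μ r) u ≠ 0 →
      cfEntry (μ r) k v u = Complex.I * covRow (μ r) k v u * cf (μ r) u := by
    intro r k v u h0 h1 hu
    refine IsCenteredLaw.cfEntry_of_logDeviation_eq_zero hu ?_
    refine eq_zero_of_scaleRows (x := x r) (q := x r k) (U := {u | cf (μ r) u ≠ 0}) (hx0 r)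
      (hx1 r) h0 h1 ((hμ r).logDeviation_isLittleO k v) (fun u hu => ?_) (fun u hu => ?_) hu
    · have := logDeviation_scaleRows hμ hμ' hB hWB r {i} k v hu
      simp only [Finset.sum_singleton] at this
      exact this
    -- The complementary contraction is `1 - x r` because `B k * W k = 1`.
    · have := logDeviation_scaleRows hμ hμ' hB hWB r {i}ᶜ k v hu
      have e : ∀ k, ∑ j ∈ ({i} : Finset (Fin N))ᶜ, W k j r * B k r j = 1 - x r k := by
        intro k
        have := Finset.sum_add_sum_compl {i} fun j => W k j r * B k r j
        rw [hsum', Finset.sum_singleton] at this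
        simp only [hx]
        linarith
      simp only [e] at this
      exact this
  have hlt : ∀ k ∈ α, x m k < 1 ∧ x n k < 1 := fun k hk => by
    have := hxmn k
    have := hαpos k hk
    constructor <;> linarith
  refine hasMatchingGaussianPair_of_splitsGaussian hμ hS hmn (α := α) ⟨k₀, by simp [hmem]⟩
    ((hμ m).splitsGaussian (fun k hk l hl v w => (hcross k hk l hl v w).1) fun k hk v u hu =>
      hlin m k v u (hαpos k hk).1 (hlt k hk).1 hu)
    ((hμ n).splitsGaussian (fun k hk l hl v w => (hcross k hk l hl v w).2) fun k hk v u hu =>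
      hlin n k v u (hαpos k hk).2 (hlt k hk).2 hu)
    -- From `x r l * R_r = B k r i * B l r i * R'_i` for `r = m, n`, eliminating `R'_i`; the weights
    -- `x` are constant on `α`, so their ratio can be shared equally between the two indices as a
    -- square root.
    (fun k => B k m i / B k n i * √(x n k₀ / x m k₀)) (fun k hk => ?_) ?_
  · refine mul_ne_zero (div_ne_zero ?_ ?_) (Real.sqrt_pos.2 (div_pos hxn hxm)).ne'
    · exact (hne k m (hαpos k hk).1).2
    · exact (hne k n (hαpos k hk).2).2
  · intro k hk l hl v w
    have hBk := (hne k n (hαpos k hk).2).2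
    have hBl := (hne l n (hαpos l hl).2).2
    have e1 : B k m i / B k n i * √(x n k₀ / x m k₀) * (B l m i / B l n i * √(x n k₀ / x m k₀)) =
        B k m i * B l m i / (B k n i * B l n i) * (x n k₀ / x m k₀) := by
      rw [mul_mul_mul_comm, Real.mul_self_sqrt (div_pos hxn hxm).le, div_mul_div_comm]
    have e2 : ∀ r, x r l * crossMoment (μ r) k v l w =
        B k r i * B l r i * crossMoment (μ' i) k v l w := by
      intro r
      simp only [hx]
      linear_combination B l r i * hrel r i k v l w
    have em := e2 m
    have en := e2 n
    rw [((hmem l).1 hl).1] at em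
    rw [((hmem l).1 hl).2] at en
    rw [e1, eq_comm, div_mul_div_comm, div_mul_eq_mul_div, div_eq_iff (by positivity)]
    linear_combination (B k m i * B l m i) * en - (B k n i * B l n i) * em

lemma IsSourceModel.hasMatchingGaussianPair_of_not_identifiable [IsProbabilityMeasure P]
    (hS : IsSourceModel P p S) {A : Fin K → Matrix (Fin N) (Fin N) ℝ}
    (hA : ∀ k, IsUnit (A k).det) (h : ¬ Identifiable P A S) : HasMatchingGaussianPair P S := by
  unfold Identifiable at h
  push Not at h
  obtain ⟨A', p', hA', hp', hlaw, k, hk⟩ := h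
  rw [hS.map_mix] at hlaw
  have hB := map_mixRows_of_observationLaw_eq hA hlaw
  have hdet : IsUnit ((A k)⁻¹ * A' k).det := by
    rw [det_mul]
    exact ((isUnit_nonsing_inv_det_iff).2 (hA k)).mul (hA' k)
  obtain ⟨i, m, n, hmn, hm, hn⟩ := exists_two_ne_zero_of_not_monomial hdet (by
    rintro ⟨l, σ, hl, hσ⟩
    refine hk l σ hl ?_
    rw [mul_assoc, ← hσ, mul_nonsing_inv_cancel_left _ _ (hA k)])
  refine hasMatchingGaussianPair_of_mixRows (fun n => (hS.density n).isCenteredLaw)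
    (fun n => (hp' n).isCenteredLaw) hS.hasLaw hB (W := fun k => (A' k)⁻¹ * A k) (fun k => ?_)
    hmn hm hn
  rw [mul_assoc, mul_nonsing_inv_cancel_left _ _ (hA k), nonsing_inv_mul _ (hA' k)]

end identifiability

/-! ### Rotating matching normal factors -/

/-- A measure on tuples of matrices is determined by its characteristic function. -/
lemma ext_of_integral_prod_wave {N K V : ℕ} {ν ν' : Measure (Fin N → SCM K V)}
    [IsFiniteMeasure ν] [IsFiniteMeasure ν']
    (h : ∀ u : Fin N → SCM K V, ∫ s, ∏ n, wave (u n) (s n) ∂ν = ∫ s, ∏ n, wave (u n) (s n) ∂ν') :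
    ν = ν' := by
  refine Measure.ext_of_charFunDual (funext fun L => ?_)
  have e : ∀ s : Fin N → SCM K V,
      L s = ∑ n, pairing (fun k v => L (Pi.single n (entryDir k v))) (s n) := by
    intro s
    have hs : s = ∑ n, ∑ k, ∑ v, s n k v • (Pi.single n (entryDir k v) : Fin N → SCM K V) := by
      ext n k v
      simp [entryDir, Finset.sum_apply, Pi.single_apply, ite_apply]
    conv_lhs => rw [hs]
    simp only [map_sum, map_smul, smul_eq_mul, pairing, mul_comm]
  have := h fun n k v => L (Pi.single n (entryDir k v))
  rw [charFunDual_apply, charFunDual_apply]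
  simpa only [prod_wave, ← e] using this

/-- The identity matrix, modified in the rows and columns `m` and `n`. -/
noncomputable def planeMatrix {N : ℕ} (m n : Fin N) (a b : ℝ) : Matrix (Fin N) (Fin N) ℝ :=
  1 + (single m m (-2 / 5) + single n n (-2 / 5) + single m n a + single n m b)

/-- The block in the `(m, n)` plane has diagonal `1 - 2 / 5 = 3 / 5`; flipping the off-diagonal
signs and multiplying gives `9 / 25 - a * b` times the identity. -/
lemma planeMatrix_mul_planeMatrix {N : ℕ} {m n : Fin N} (hmn : m ≠ n) {a b : ℝ}
    (hab : a * b = -16 / 25) : planeMatrix m n a b * planeMatrix m n (-a) (-b) = 1 := by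
  have hab' : a * -b = 16 / 25 := by linarith
  have hba' : b * -a = 16 / 25 := by linarith
  simp only [planeMatrix, mul_add, add_mul, one_mul, mul_one, single_mul_single_same,
    single_mul_single_of_ne _ _ _ _ hmn, single_mul_single_of_ne _ _ _ _ hmn.symm, hab', hba']
  ext i j
  simp only [Matrix.add_apply, single_apply, Matrix.zero_apply, one_apply]
  split_ifs <;> linarith

lemma sum_planeMatrix_mul {N : ℕ} (m n : Fin N) (a b : ℝ) (f : Fin N → ℝ) (j : Fin N) :
    ∑ i, planeMatrix m n a b i j * f i =
      f j + ((if j = m then -2 / 5 * f m + b * f n else 0) +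
        if j = n then -2 / 5 * f n + a * f m else 0) := by
  simp only [planeMatrix, Matrix.add_apply, single_apply, one_apply, add_mul, ite_mul, zero_mul, one_mul,
    ite_and, Finset.sum_add_distrib, Finset.sum_ite_eq, Finset.sum_ite_eq', Finset.mem_univ,
    if_true, eq_comm (a := j)]
  split_ifs <;> ring

section nonidentifiability

variable {N K V : ℕ} {μ : Fin N → Measure (SCM K V)}

lemma integral_pairing_onRows_sq_eq {ν ν' : Measure (SCM K V)} (h : IsCenteredLaw ν)
    (h' : IsCenteredLaw ν') {α : Finset (Fin K)} {d : Fin K → ℝ}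
    (hcov : ∀ k ∈ α, ∀ l ∈ α, ∀ v w,
      crossMoment ν k v l w = d k * d l * crossMoment ν' k v l w) (u : SCM K V) :
    ∫ x, pairing (onRows α u) x ^ 2 ∂ν = ∫ x, pairing (onRows α (scaleRows d u)) x ^ 2 ∂ν' := by
  simp only [sq, h.integral_pairing_mul_pairing, h'.integral_pairing_mul_pairing]
  refine Finset.sum_congr rfl fun k _ => Finset.sum_congr rfl fun v _ => ?_
  refine Finset.sum_congr rfl fun l _ => Finset.sum_congr rfl fun w _ => ?_
  by_cases hk : k ∈ α <;> by_cases hl : l ∈ α <;> simp [onRows, scaleRows, hk, hl]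
  rw [hcov k hk l hl]
  ring

/-- A suitable mixture of two sources with matching normal factors, within these factors, does not
change the joint law of the sources. -/
lemma map_mixRows_planeMatrix (hμ : ∀ n, IsCenteredLaw (μ n)) {m n : Fin N} (hmn : m ≠ n)
    {α : Finset (Fin K)} (hm : SplitsGaussian (μ m) α) (hn : SplitsGaussian (μ n) α)
    {d : Fin K → ℝ} (hd : ∀ k ∈ α, d k ≠ 0) (hcov : ∀ k ∈ α, ∀ l ∈ α, ∀ v w,
      crossMoment (μ m) k v l w = d k * d l * crossMoment (μ n) k v l w) :
    (Measure.pi μ).map (mixRows fun k =>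
      if k ∈ α then planeMatrix m n (-(4 / 5) * d k) (4 / 5 / d k) else 1) = Measure.pi μ := by
  have := fun n => (hμ n).isProb
  set T : Fin K → Matrix (Fin N) (Fin N) ℝ := fun k =>
    if k ∈ α then planeMatrix m n (-(4 / 5) * d k) (4 / 5 / d k) else 1 with hT
  have hTm := (continuous_mixRows (V := V) T).measurable
  have := Measure.isProbabilityMeasure_map (μ := Measure.pi μ) hTm.aemeasurable
  refine ext_of_integral_prod_wave fun u => ?_
  rw [integral_map hTm.aemeasurable (continuous_prod_wave u).aestronglyMeasurable]
  simp only [prod_wave_mixRows]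
  rw [integral_prod_wave hμ, integral_prod_wave hμ]
  set t := mixRows (fun k => (T k)ᵀ) u with ht
  have htα : ∀ k ∈ α, ∀ j v, t j k v = u j k v +
      ((if j = m then -2 / 5 * u m k v + 4 / 5 / d k * u n k v else 0) +
        if j = n then -2 / 5 * u n k v + -(4 / 5) * d k * u m k v else 0) := by
    intro k hk j v
    simp only [ht, mixRows, transpose_apply, hT, if_pos hk]
    exact sum_planeMatrix_mul m n _ _ (fun i => u i k v) j
  have htc : ∀ j, onRows αᶜ (t j) = onRows αᶜ (u j) := by
    intro j
    ext k v
    by_cases hk : k ∈ α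
    · simp [onRows, hk]
    · simp [onRows, hk, ht, mixRows, hT, one_apply]
  have hne : ∀ j, j ≠ m → j ≠ n → t j = u j := by
    intro j hjm hjn
    ext k v
    by_cases hk : k ∈ α
    · simp [htα k hk, hjm, hjn]
    · simpa [onRows, hk] using congrFun (congrFun (htc j) k) v
  set a := onRows α (scaleRows d (u m)) with ha
  set b := onRows α (u n) with hb
  -- In the coordinates `a`, `b`, in which both normal factors have the covariance of source `n`,
  -- the mixture is a rotation with cosine `3 / 5` and sine `4 / 5`. It preserves the sum of the two
  -- quadratic forms.
  have ham : onRows α (scaleRows d (t m)) = (3 / 5 : ℝ) • a + (4 / 5 : ℝ) • b := by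
    ext k v
    by_cases hk : k ∈ α
    · have := hd k hk
      simp [ha, hb, onRows, scaleRows, hk, htα k hk, hmn]
      field_simp
      ring
    · simp [ha, hb, onRows, hk]
  have han : onRows α (t n) = (-4 / 5 : ℝ) • a + (3 / 5 : ℝ) • b := by
    ext k v
    by_cases hk : k ∈ α
    · simp [ha, hb, onRows, scaleRows, hk, htα k hk, hmn.symm]
      ring
    · simp [ha, hb, onRows, hk]
  have hI : ∀ w, Integrable (fun x => pairing w x ^ 2) (μ n) :=
    fun w => ((hμ n).memLp_pairing w).integrable_sq
  have hquad : (∫ x, pairing (onRows α (t m)) x ^ 2 ∂μ m) +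
      ∫ x, pairing (onRows α (t n)) x ^ 2 ∂μ n =
      (∫ x, pairing (onRows α (u m)) x ^ 2 ∂μ m) + ∫ x, pairing (onRows α (u n)) x ^ 2 ∂μ n := by
    rw [integral_pairing_onRows_sq_eq (hμ m) (hμ n) hcov,
      integral_pairing_onRows_sq_eq (hμ m) (hμ n) hcov, ham, han, ← integral_add (hI _) (hI _),
      ← integral_add (hI _) (hI _)]
    refine integral_congr_ae (Filter.Eventually.of_forall fun x => ?_)
    simp only [pairing_add_left, pairing_smul_left]
    ring
  have hpair : cf (μ m) (t m) * cf (μ n) (t n) = cf (μ m) (u m) * cf (μ n) (u n) := by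
    rw [hm (t m), hn (t n), hm (u m), hn (u n), htc, htc, mul_mul_mul_comm, ← Complex.exp_add,
      mul_mul_mul_comm (Complex.exp _) _ (Complex.exp _), ← Complex.exp_add, ← add_div,
      ← add_div, ← neg_add, ← neg_add, ← Complex.ofReal_add, ← Complex.ofReal_add, hquad]
  have hnm : n ∈ Finset.univ.erase m := Finset.mem_erase.2 ⟨hmn.symm, Finset.mem_univ n⟩
  rw [← Finset.mul_prod_erase _ _ (Finset.mem_univ m), ← Finset.mul_prod_erase _ _ hnm,
    ← Finset.mul_prod_erase _ (fun j => cf (μ j) (u j)) (Finset.mem_univ m),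
    ← Finset.mul_prod_erase _ (fun j => cf (μ j) (u j)) hnm, ← mul_assoc, ← mul_assoc, hpair]
  congr 1
  refine Finset.prod_congr rfl fun j hj => ?_
  rw [hne j (Finset.ne_of_mem_erase (Finset.mem_of_mem_erase hj)) (Finset.ne_of_mem_erase hj)]

variable {Ω : Type*} [MeasurableSpace Ω] {P : Measure Ω}
  {p : Fin N → SCM K V → ℝ} {S : Fin N → Ω → SCM K V}

/-- The competing model keeps the densities `p` and uses the mixing matrices `A k * T k`, where `T`
preserves the joint source law. At `k₀ ∈ α`, row `m` of `T k₀` has nonzero entries in columns `m`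
and `n`, so it is not diagonal times permutation. -/
lemma IsSourceModel.not_identifiable_of_hasMatchingGaussianPair [IsProbabilityMeasure P]
    (hS : IsSourceModel P p S) {A : Fin K → Matrix (Fin N) (Fin N) ℝ}
    (hA : ∀ k, IsUnit (A k).det) (h : HasMatchingGaussianPair P S) : ¬ Identifiable P A S := by
  obtain ⟨α, ⟨k₀, hk₀⟩, m, n, hmn, hm, hn, d', hd', hcov'⟩ := h
  have hμ := fun n => (hS.density n).isCenteredLaw
  -- The value outside `α` is immaterial, since the mixture is the identity there.
  set d : Fin K → ℝ := fun k => if hk : k ∈ α then d' ⟨k, hk⟩ else 1 with hdef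
  have hd : ∀ k ∈ α, d k ≠ 0 := fun k hk => by simpa [hdef, hk] using hd' ⟨k, hk⟩
  have hcov : ∀ k ∈ α, ∀ l ∈ α, ∀ v w, crossMoment (sourceLaw (p m)) k v l w =
      d k * d l * crossMoment (sourceLaw (p n)) k v l w := by
    intro k hk l hl v w
    have := congrFun (congrFun hcov' (v, ⟨k, hk⟩)) (w, ⟨l, hl⟩)
    rw [← diagonal_one, diagonal_kronecker_diagonal, mul_diagonal, diagonal_mul,
      covRows_apply (hS.hasLaw m), covRows_apply (hS.hasLaw n)] at this
    simp only [hdef, hk, hl, dif_pos]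
    rw [this]
    ring
  have hT := map_mixRows_planeMatrix hμ hmn (hm.splitsGaussian (hμ m) (hS.hasLaw m))
    (hn.splitsGaussian (hμ n) (hS.hasLaw n)) hd hcov
  set T : Fin K → Matrix (Fin N) (Fin N) ℝ := fun k =>
    if k ∈ α then planeMatrix m n (-(4 / 5) * d k) (4 / 5 / d k) else 1 with hTdef
  have hTdet : ∀ k, IsUnit (T k).det := by
    intro k
    by_cases hk : k ∈ α
    · have hdk := hd k hk
      simp only [hTdef, if_pos hk]
      exact isUnit_det_of_right_inverse (planeMatrix_mul_planeMatrix hmn (by field_simp; norm_num))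
    · simp [hTdef, hk]
  intro hid
  have hlaw : observationLaw (fun k => A k * T k) p = P.map (fun ω => mix A fun n => S n ω) := by
    have e : (mix (fun k => A k * T k) : (Fin N → SCM K V) → _) = mix A ∘ mixRows T := by
      ext s k i v
      simp only [Function.comp_apply, mix_apply, mixRows_mixRows]
    rw [hS.map_mix, observationLaw, e, ← Measure.map_map (continuous_mix A).measurable
      (continuous_mixRows T).measurable, hT, observationLaw]
  obtain ⟨l, σ, -, hσ⟩ := hid (fun k => A k * T k) p
    (fun k => by rw [det_mul]; exact (hA k).mul (hTdet k)) hS.density hlaw k₀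
  have hTk : T k₀ = diagonal l * σ.permMatrix ℝ := by
    have := congrArg (fun C => (A k₀)⁻¹ * C) hσ
    simpa only [mul_assoc, nonsing_inv_mul_cancel_left _ _ (hA k₀)] using this
  have hrow : ∀ j, T k₀ m j ≠ 0 → σ m = j := by
    intro j hj
    by_contra hne
    rw [hTk, diagonal_mul, Equiv.Perm.permMatrix, PEquiv.toMatrix_apply] at hj
    exact hj (by simp [hne])
  have h1 : σ m = m := hrow m (by
    simp [hTdef, hk₀, planeMatrix, hmn.symm]
    norm_num)
  have h2 : σ m = n := hrow n (by
    simp [hTdef, hk₀, planeMatrix, hmn, hmn.symm, hd k₀ hk₀])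
  exact hmn (h1.symm.trans h2)

end nonidentifiability

end IVA

theorem theorem1 {N K V : ℕ} {Ω : Type*} [MeasurableSpace Ω] (P : Measure Ω)
    [IsProbabilityMeasure P] (p : Fin N → SCM K V → ℝ) (S : Fin N → Ω → SCM K V)
    (hS : IVA.IsSourceModel P p S)
    (A : Fin K → Matrix (Fin N) (Fin N) ℝ) (hA : ∀ k, IsUnit (A k).det) :
    (¬ IVA.Identifiable P A S ↔ IVA.HasMatchingGaussianPair P S) ∧
    ((∃ m n : Fin N, m ≠ n ∧ ¬ IsUnit (IVA.fisherBlock P p S m n).det) ↔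
      IVA.HasMatchingGaussianPair P S) :=
  ⟨⟨hS.hasMatchingGaussianPair_of_not_identifiable hA,
    hS.not_identifiable_of_hasMatchingGaussianPair hA⟩, hS.exists_singular_fisherBlock_iff⟩
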